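/- Fix $M\ge 1$ and probability densities $f_1,\dots,f_M$ on $\mathbb R$; put $f_m(x;\mu,\sigma)=\frac1\sigma f_m\!\left(\frac{x-\mu}{\sigma}\right)$ for $\mu\in\mathbb R$, $\sigma>0$. Let $\Theta$ be the set of $\theta=(\alpha_1,\mu_1,\sigma_1,\dots,\alpha_M,\mu_M,\sigma_M)$ with $\alpha_m\ge 0$, $\sum_m\alpha_m=1$, $\mu_m\in\mathbb R$, $\sigma_m>0$, with the maximum distance $\mathrm{dist}$ of $\mathbb R^{3M}$, and let $f(x;\theta)=\sum_{m=1}^M\alpha_m f_m(x;\mu_m,\sigma_m)$. For $\theta'\in\Theta$ let $\Theta(\theta')$ be the set of all $\theta\in\Theta$ with $f(\cdot;\theta)=f(\cdot;\theta')$ almost everywhere. Fix $\theta_0\in\Theta$, let $\Theta_0=\Theta(\theta_0)$, and let $X_1,X_2,\dots$ be i.i.d. with density $f(\cdot;\theta_0)$. Assume the following. 1. For each $\theta\in\Theta$ and all sufficiently small $\rho>0$ the function $x\mapsto\sup\{f(x;\theta'):\theta'\in\Theta,\ \mathrm{dist}(\theta',\theta)\le\rho\}$ is Lebesgue measurable.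 2. For each compact $\Gamma\subset\Theta$ and each $\theta\in\Gamma$ there is a null set, not depending on the sequence, outside which $f(x;\theta^{(j)})\to f(x;\theta)$ whenever $\theta^{(j)}\in\Gamma$ and $\theta^{(j)}\to\theta$. 3. $\int|\log f(x;\theta_0)|\,f(x;\theta_0)\,dx<\infty$. 4. There are $v_0,v_1>0$ and $\beta>1$ with $f_m(x)\le\min\{v_0,\,v_1|x|^{-\beta}\}$ for all $m$ and $x$ (the second bound being $+\infty$ at $x=0$). 5. $f(\cdot;\theta_0)$ has exactly $M$ components: no $\theta\in\Theta$ with at most $M-1$ nonzero weights satisfies $f(\cdot;\theta)=f(\cdot;\theta_0)$ almost everywhere. Let $\bar s_n:(0,\infty)\to\mathbb R$ $(n\ge1)$ and $s_n(\theta)=\prod_{m=1}^M\bar s_n(\sigma_m)$, and assume: 6. there is $\bar S<\infty$ with $0\le\bar s_n(y)\le\bar S$ for all $n$ and $y>0$, and $\sup_{y>0}\bar s_n(y)>0$ for all $n$; 7. there are $\bar s>0$ and $0\le d<1$ with $0<\sup_{y>0}\bar s_n(y)/y^M\le\bar s\,e^{n^d}$ for all $n$; 8. there are $s_{\Theta_0}>0$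 and a positive integer $N$ with $s_n(\theta)\ge s_{\Theta_0}$ for all $\theta\in\Theta_0$ and $n\ge N$. Let $\hat\theta_n$ be a penalized maximum likelihood estimator, i.e. almost surely, for all sufficiently large $n$, $\hat\theta_n$ maximizes $$h_n(\theta)=s_n(\theta)\prod_{i=1}^n f(X_i;\theta)$$ over $\theta\in\Theta$. Then $\hat\theta_n$ is strongly consistent: almost surely $$\lim_{n\to\infty}\ \inf_{\theta\in\Theta(\hat\theta_n),\ \theta'\in\Theta_0}\mathrm{dist}(\theta,\theta')=0 .$$ -/

import Mathlib

open MeasureTheory ProbabilityTheory Filter Topology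
open scoped ENNReal

namespace LocScaleMixture

/-- The ambient space of parameter vectors
`θ = (α₁, μ₁, σ₁, …, α_M, μ_M, σ_M)`, with the (maximum) product metric. -/
abbrev Param (M : ℕ) : Type := Fin M → ℝ × ℝ × ℝ

/-- The mixing weight `α_m`. -/
def weight {M : ℕ} (θ : Param M) (m : Fin M) : ℝ := (θ m).1

/-- The location parameter `μ_m`. -/
def loc {M : ℕ} (θ : Param M) (m : Fin M) : ℝ := (θ m).2.1

/-- The scale parameter `σ_m`. -/
def scale {M : ℕ} (θ : Param M) (m : Fin M) : ℝ := (θ m).2.2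

/-- The parameter space `Θ`: nonnegative weights with sum one, real locations, positive scales. -/
def paramSpace (M : ℕ) : Set (Param M) :=
  {θ | (∀ m, 0 ≤ weight θ m) ∧ ∑ m, weight θ m = 1 ∧ ∀ m, 0 < scale θ m}

/-- `g` is a probability density on the real line with respect to Lebesgue measure. -/
def IsDensity (g : ℝ → ℝ) : Prop :=
  (∀ x, 0 ≤ g x) ∧ Integrable g volume ∧ ∫ x, g x = 1

/-- The location-scale density `g(x; μ, σ) = σ⁻¹ g((x - μ) / σ; 0, 1)`
generated by `g = g(·; 0, 1)`. -/
noncomputable def locScale (g : ℝ → ℝ) (μ σ x : ℝ) : ℝ := 1 / σ * g ((x - μ) / σ)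

/-- The mixture density `f(x; θ) = ∑ₘ αₘ fₘ(x; μₘ, σₘ)`,
where `f m` is the standard member `fₘ(·; 0, 1)` of the `m`-th location-scale family. -/
noncomputable def mixture {M : ℕ} (f : Fin M → ℝ → ℝ) (θ : Param M) (x : ℝ) : ℝ :=
  ∑ m, weight θ m * locScale (f m) (loc θ m) (scale θ m) x

/-- `f(x; θ, ρ)`, the supremum of `f(x; θ')` over all `θ' ∈ Θ` at distance at most `ρ` from `θ`. -/
noncomputable def supMixture {M : ℕ} (f : Fin M → ℝ → ℝ) (θ : Param M) (ρ : ℝ) (x : ℝ) : ℝ≥0∞ :=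
  ⨆ θ' ∈ paramSpace M ∩ Metric.closedBall θ ρ, ENNReal.ofReal (mixture f θ' x)

/-- For every `θ ∈ Θ` and all sufficiently small `ρ > 0`, the function `x ↦ f(x; θ, ρ)` is
(Lebesgue) measurable. -/
def SupMeasurable {M : ℕ} (f : Fin M → ℝ → ℝ) : Prop :=
  ∀ θ ∈ paramSpace M, ∃ ρ₀ > 0, ∀ ρ, 0 < ρ → ρ < ρ₀ → AEMeasurable (supMixture f θ ρ) volume

/-- For every compact `Γ ⊆ Θ` and every `θ ∈ Γ`, outside a Lebesgue null set of `x` which does not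
depend on the sequence, `θ⁽ʲ⁾ → θ` with `θ⁽ʲ⁾ ∈ Γ` implies `f(x; θ⁽ʲ⁾) → f(x; θ)`. -/
def AEContinuousInParam {M : ℕ} (f : Fin M → ℝ → ℝ) : Prop :=
  ∀ Γ : Set (Param M), Γ ⊆ paramSpace M → IsCompact Γ → ∀ θ ∈ Γ,
    ∀ᵐ x ∂(volume : Measure ℝ), ∀ u : ℕ → Param M, (∀ j, u j ∈ Γ) → Tendsto u atTop (𝓝 θ) →
      Tendsto (fun j => mixture f (u j) x) atTop (𝓝 (mixture f θ x))

/-- `∫ |log f(x; θ₀)| f(x; θ₀) dx < ∞`. -/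
def LogIntegrable {M : ℕ} (f : Fin M → ℝ → ℝ) (θ₀ : Param M) : Prop :=
  Integrable (fun x => |Real.log (mixture f θ₀ x)| * mixture f θ₀ x) volume

/-- There are `v₀, v₁ > 0` and `β > 1` with `fₘ(x; 0, 1) ≤ min {v₀, v₁ |x|^(-β)}` for all `m`, `x`.
At `x = 0` the second bound is infinite, that is, void. -/
def TailBound {M : ℕ} (f : Fin M → ℝ → ℝ) : Prop :=
  ∃ v₀ > 0, ∃ v₁ > 0, ∃ β > (1 : ℝ), ∀ m x,
    f m x ≤ v₀ ∧ (x ≠ 0 → f m x ≤ v₁ * |x| ^ (-β))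

/-- `g` is (a version of) a mixture density with no more than `k` components, that is,
`g` belongs to `𝒢ₖ`; densities that agree almost everywhere are identified. -/
def HasAtMostComponents {M : ℕ} (f : Fin M → ℝ → ℝ) (k : ℕ) (g : ℝ → ℝ) : Prop :=
  ∃ θ ∈ paramSpace M, {m | weight θ m ≠ 0}.ncard ≤ k ∧ g =ᵐ[volume] mixture f θ

/-- `Θ(θ')`, the set of parameters in `Θ` whose density agrees with `f(·; θ')` almost everywhere. -/
def equivParams {M : ℕ} (f : Fin M → ℝ → ℝ) (θ' : Param M) : Set (Param M) :=
  {θ | θ ∈ paramSpace M ∧ mixture f θ =ᵐ[volume] mixture f θ'}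

/-- `dist(U, V) = inf_{θ ∈ U} inf_{θ' ∈ V} dist(θ, θ')`. -/
noncomputable def setDist {M : ℕ} (U V : Set (Param M)) : ℝ≥0∞ :=
  ⨅ θ ∈ U, ⨅ θ' ∈ V, edist θ θ'

/-- The likelihood `l(θ; x₁, …, xₙ)` of the first `n` terms of the sequence `x`. -/
noncomputable def likelihood {M : ℕ} (f : Fin M → ℝ → ℝ) (n : ℕ) (x : ℕ → ℝ) (θ : Param M) : ℝ :=
  ∏ i ∈ Finset.range n, mixture f θ (x i)

/-- The reward function `sₙ(θ) = ∏ₘ s̄ₙ(σₘ)`. -/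
noncomputable def reward {M : ℕ} (sbar : ℕ → ℝ → ℝ) (n : ℕ) (θ : Param M) : ℝ :=
  ∏ m, sbar n (scale θ m)

/-- The penalized likelihood `hₙ(θ; x₁, …, xₙ) = l(θ; x₁, …, xₙ) sₙ(θ)`. -/
noncomputable def penalizedLikelihood {M : ℕ} (f : Fin M → ℝ → ℝ) (sbar : ℕ → ℝ → ℝ) (n : ℕ)
    (x : ℕ → ℝ) (θ : Param M) : ℝ :=
  likelihood f n x θ * reward sbar n θ

/-- `s̄ₙ` is nonnegative, bounded uniformly in `n`, and not identically zero on `(0, ∞)`. -/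
def RewardBounded (sbar : ℕ → ℝ → ℝ) : Prop :=
  ∃ S : ℝ, ∀ n : ℕ, 1 ≤ n →
    (∀ y > 0, 0 ≤ sbar n y ∧ sbar n y ≤ S) ∧ ∃ y > 0, 0 < sbar n y

/-- There are `s̄ > 0` and `0 ≤ d < 1` with `0 < sup_{y > 0} s̄ₙ(y) / y^M ≤ s̄ exp(n^d)`
for all `n`. -/
def RewardDecay (M : ℕ) (sbar : ℕ → ℝ → ℝ) : Prop :=
  ∃ s > 0, ∃ d : ℝ, 0 ≤ d ∧ d < 1 ∧ ∀ n : ℕ, 1 ≤ n →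
    (∃ y > 0, 0 < sbar n y / y ^ M) ∧
    ∀ y > 0, sbar n y / y ^ M ≤ s * Real.exp ((n : ℝ) ^ d)

/-- `sₙ` is bounded below by a positive constant on `Θ₀ = Θ(θ₀)` for all large `n`. -/
def RewardBoundedBelow {M : ℕ} (f : Fin M → ℝ → ℝ) (sbar : ℕ → ℝ → ℝ) (θ₀ : Param M) : Prop :=
  ∃ s > 0, ∃ N : ℕ, 0 < N ∧ ∀ θ ∈ equivParams f θ₀, ∀ n ≥ N, s ≤ reward sbar n θ

/-- `θ` is a penalized maximum likelihood estimate based on `x₁, …, xₙ`: a maximizer of `hₙ`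
over `Θ`. -/
def IsPenalizedMLE {M : ℕ} (f : Fin M → ℝ → ℝ) (sbar : ℕ → ℝ → ℝ) (n : ℕ) (x : ℕ → ℝ)
    (θ : Param M) : Prop :=
  θ ∈ paramSpace M ∧
    ∀ θ' ∈ paramSpace M, penalizedLikelihood f sbar n x θ' ≤ penalizedLikelihood f sbar n x θ

/-- Strong consistency: `dist(Θ(θ̂ₙ), Θ₀) → 0` almost surely. -/
def StronglyConsistent {M : ℕ} (f : Fin M → ℝ → ℝ) {Ω : Type*} [MeasurableSpace Ω]
    (P : Measure Ω) (θ₀ : Param M) (θhat : ℕ → Ω → Param M) : Prop :=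
  ∀ᵐ ω ∂P, Tendsto (fun n => setDist (equivParams f (θhat n ω)) (equivParams f θ₀)) atTop (𝓝 0)

end LocScaleMixture

open LocScaleMixture

/-! The proof is Wald's consistency argument, with ultrafilters in place of a compactification of
`Θ`. Sets of parameters that eventually lose to `θ₀` almost surely form an ideal, so it is enough to
find such a set in each ultrafilter `F` containing `Θ`, unless `F` converges to a point of `Θ₀`
(`le_nhds_or_eventuallyBeaten`, `eventuallyBeaten_of_ultrafilter`).

Along `F` each component either has scale tending to zero, or escapes through its location or scale,
or converges (`exists_componentEnvelope`). Dropping the first two kinds leaves a limit mixture of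
mass at most one. If it equals `f(·; θ₀)` almost everywhere, minimality of the number of components
forbids any loss, and `F` converges to a point of `Θ₀`. Otherwise a bounded envelope of the limit
has negative mean log-ratio against `f(·; θ₀)` (`exists_integral_mul_log_sub_log_neg`), and the law
of large numbers makes the likelihood ratio of the envelope decay exponentially.

What the envelope misses is a narrow spike around the location of each collapsing component. A spike
of scale `σ` multiplies the likelihood by about `1 / σ` per observation it captures. If `σ` is not
polynomially small in `n`, it captures too few observations for this to matter on the exponential
scale; if it is, it captures at most one, and the reward, being `O(σ)` up to `exp (n ^ d)`, pays for
it (`exists_prod_spike_mul_le`). The counts rest on the bounded density of the sample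
(`measure_exists_crowded_le`). -/

namespace LocScaleMixture

/-! ### Elementary bounds for location-scale densities and mixtures. -/

lemma locScale_nonneg {g : ℝ → ℝ} (hg : ∀ x, 0 ≤ g x) {μ σ : ℝ} (hσ : 0 < σ) (x : ℝ) :
    0 ≤ locScale g μ σ x :=
  mul_nonneg (by positivity) (hg _)

lemma locScale_le_div {g : ℝ → ℝ} {v : ℝ} (hg : ∀ x, g x ≤ v) {μ σ : ℝ} (hσ : 0 < σ) (x : ℝ) :
    locScale g μ σ x ≤ v / σ := by
  unfold locScale
  rw [div_mul_eq_mul_div, one_mul]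
  gcongr
  exact hg _

lemma locScale_le_tail {g : ℝ → ℝ} {v β : ℝ} (hg : ∀ x, x ≠ 0 → g x ≤ v * |x| ^ (-β)) {μ σ x : ℝ}
    (hσ : 0 < σ) (hx : x ≠ μ) :
    locScale g μ σ x ≤ v * σ ^ (β - 1) * |x - μ| ^ (-β) := by
  have h1 : (x - μ) / σ ≠ 0 := div_ne_zero (sub_ne_zero.2 hx) hσ.ne'
  have h2 : 0 < |x - μ| := abs_pos.2 (sub_ne_zero.2 hx)
  calc locScale g μ σ x ≤ 1 / σ * (v * |(x - μ) / σ| ^ (-β)) := by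
        unfold locScale
        gcongr
        exact hg _ h1
    _ = v * σ ^ (β - 1) * |x - μ| ^ (-β) := by
        rw [abs_div, abs_of_pos hσ, Real.div_rpow h2.le hσ.le, Real.rpow_sub hσ, Real.rpow_one,
          Real.rpow_neg hσ.le]
        field_simp

lemma integrable_locScale {g : ℝ → ℝ} (hg : IsDensity g) (μ : ℝ) {σ : ℝ} (hσ : 0 < σ) :
    Integrable (locScale g μ σ) :=
  ((hg.2.1.comp_div hσ.ne').comp_sub_right μ).const_mul _

lemma integral_locScale {g : ℝ → ℝ} (hg : IsDensity g) (μ : ℝ) {σ : ℝ} (hσ : 0 < σ) :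
    ∫ x, locScale g μ σ x = 1 := by
  unfold locScale
  rw [integral_const_mul, integral_sub_right_eq_self (fun x => g (x / σ)) μ,
    Measure.integral_comp_div, hg.2.2, abs_of_pos hσ]
  simp [hσ.ne']

section Mixture

variable {M : ℕ} {f : Fin M → ℝ → ℝ} {θ : Param M}

lemma mixture_nonneg (hf : ∀ m, IsDensity (f m)) (hw : ∀ m, 0 ≤ weight θ m)
    (hs : ∀ m, 0 < scale θ m) (x : ℝ) : 0 ≤ mixture f θ x :=
  Finset.sum_nonneg fun m _ => mul_nonneg (hw m) (locScale_nonneg (hf m).1 (hs m) x)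

lemma integrable_mixture (hf : ∀ m, IsDensity (f m)) (hs : ∀ m, 0 < scale θ m) :
    Integrable (mixture f θ) :=
  integrable_finsetSum _ fun m _ => (integrable_locScale (hf m) _ (hs m)).const_mul _

lemma integral_mixture (hf : ∀ m, IsDensity (f m)) (hs : ∀ m, 0 < scale θ m) :
    ∫ x, mixture f θ x = ∑ m, weight θ m := by
  unfold mixture
  rw [integral_finsetSum _ fun m _ => (integrable_locScale (hf m) _ (hs m)).const_mul _]
  refine Finset.sum_congr rfl fun m _ => ?_
  rw [integral_const_mul, integral_locScale (hf m) _ (hs m), mul_one]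

lemma weight_le_one (hθ : θ ∈ paramSpace M) (m : Fin M) : weight θ m ≤ 1 := by
  rw [← hθ.2.1]
  exact Finset.single_le_sum (f := weight θ) (fun i _ => hθ.1 i) (Finset.mem_univ m)

lemma mixture_le_sum_div {v : ℝ} (hv : ∀ m x, f m x ≤ v) (hv0 : 0 ≤ v) (hθ : θ ∈ paramSpace M) (x : ℝ) :
    mixture f θ x ≤ ∑ m, v / scale θ m := by
  refine Finset.sum_le_sum fun m _ => ?_
  have h0 : 0 ≤ v / scale θ m := div_nonneg hv0 (hθ.2.2 m).le
  calc _ ≤ weight θ m * (v / scale θ m) :=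
        mul_le_mul_of_nonneg_left (locScale_le_div (hv m) (hθ.2.2 m) x) (hθ.1 m)
    _ ≤ 1 * (v / scale θ m) := mul_le_mul_of_nonneg_right (weight_le_one hθ m) h0
    _ = _ := one_mul _

end Mixture

/-- The cells of length `2w` overlap: each is two adjacent cells of the grid of mesh `w`, and these
partition the line. -/
lemma tsum_measure_Ico_le (ν : Measure ℝ) [IsProbabilityMeasure ν] {w : ℝ} (hw : 0 < w) :
    ∑' k : ℤ, ν (Set.Ico (k • w) ((k + 2) • w)) ≤ 2 := by
  have h1 : ∑' k : ℤ, ν (Set.Ico (k • w) ((k + 1) • w)) = 1 := by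
    rw [← measure_iUnion (Set.pairwise_disjoint_Ico_zsmul w) fun _ => measurableSet_Ico,
      iUnion_Ico_zsmul hw, measure_univ]
  have h2 : ∑' k : ℤ, ν (Set.Ico ((k + 1) • w) ((k + 1 + 1) • w)) = 1 := by
    rw [← h1]
    exact (Equiv.addRight (1 : ℤ)).tsum_eq fun k => ν (Set.Ico (k • w) ((k + 1) • w))
  calc ∑' k : ℤ, ν (Set.Ico (k • w) ((k + 2) • w))
      ≤ ∑' k : ℤ, (ν (Set.Ico (k • w) ((k + 1) • w)) +
          ν (Set.Ico ((k + 1) • w) ((k + 1 + 1) • w))) := by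
        refine ENNReal.tsum_le_tsum fun k => ?_
        refine (measure_mono ?_).trans (measure_union_le _ _)
        rw [show k + 1 + 1 = k + 2 by ring]
        exact Set.Ico_subset_Ico_union_Ico
    _ = 2 := by rw [ENNReal.tsum_add, h1, h2]; norm_num

/-! ### Crowding of an i.i.d. sample with bounded density. -/

section Sample

variable {Ω : Type*} [MeasurableSpace Ω] {P : Measure Ω} {X : ℕ → Ω → ℝ}
  {ν : Measure ℝ}

/-- Any window of length `w` lies in one of countably many grid cells of length `2w`, so a union
bound over cells and index sets of size `s + 1` applies. Of the `s + 1` factors `ν (C k)`, `s` are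
bounded by `2Vw`; the last is kept so that the sum over infinitely many cells converges. -/
lemma measure_exists_crowded_le [IsProbabilityMeasure ν] (hX : ∀ i, Measurable (X i))
    (hind : iIndepFun X P) (hlaw : ∀ i, P.map (X i) = ν) {V : ℝ} (hV : 0 ≤ V)
    (hνV : ∀ S, ν S ≤ ENNReal.ofReal V * volume S) {w : ℝ} (hw : 0 < w) (n s : ℕ) :
    P {ω | ∃ a, s + 1 ≤ ((Finset.range n).filter fun i => X i ω ∈ Set.Icc a (a + w)).card} ≤
      ENNReal.ofReal (2 * (n.choose (s + 1) * (2 * V * w) ^ s)) := by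
  let C : ℤ → Set ℝ := fun k => Set.Ico (k • w) ((k + 2) • w)
  have hC : ∀ k, MeasurableSet (C k) := fun k => measurableSet_Ico
  have hνC : ∀ k, ν (C k) ≤ ENNReal.ofReal (2 * V * w) := fun k => by
    refine (hνV _).trans ?_
    rw [Real.volume_Ico, ← ENNReal.ofReal_mul hV]
    refine ENNReal.ofReal_le_ofReal (le_of_eq ?_)
    simp only [zsmul_eq_mul]
    push_cast
    ring
  have hsub : {ω | ∃ a, s + 1 ≤ ((Finset.range n).filter fun i => X i ω ∈ Set.Icc a (a + w)).card} ⊆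
      ⋃ k, ⋃ T ∈ (Finset.range n).powersetCard (s + 1), ⋂ i ∈ T, X i ⁻¹' C k := by
    rintro ω ⟨a, ha⟩
    obtain ⟨T, hT, hTc⟩ := Finset.exists_subset_card_eq ha
    simp only [Set.mem_iUnion, Set.mem_iInter]
    refine ⟨⌊a / w⌋, T, Finset.mem_powersetCard.2
      ⟨hT.trans (Finset.filter_subset _ _), hTc⟩, fun i hi => ?_⟩
    have h := (Finset.mem_filter.1 (hT hi)).2
    have h1 : (⌊a / w⌋ : ℝ) * w ≤ a := (le_div_iff₀ hw).1 (Int.floor_le _)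
    have h2 : a < (⌊a / w⌋ + 1 : ℝ) * w := (div_lt_iff₀ hw).1 (Int.lt_floor_add_one _)
    constructor
    · rw [zsmul_eq_mul]; exact h1.trans h.1
    · rw [zsmul_eq_mul]; push_cast; linarith [h.2]
  calc _ ≤ P (⋃ k, ⋃ T ∈ (Finset.range n).powersetCard (s + 1), ⋂ i ∈ T, X i ⁻¹' C k) :=
        measure_mono hsub
    _ ≤ ∑' k, ∑ T ∈ (Finset.range n).powersetCard (s + 1), P (⋂ i ∈ T, X i ⁻¹' C k) :=
        (measure_iUnion_le _).trans
          (ENNReal.tsum_le_tsum fun k => measure_biUnion_finset_le _ _)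
    _ = ∑' k, (n.choose (s + 1) : ℝ≥0∞) * ν (C k) ^ (s + 1) := by
        refine tsum_congr fun k => ?_
        rw [Finset.sum_congr rfl (g := fun _ => ν (C k) ^ (s + 1)), Finset.sum_const,
          Finset.card_powersetCard, Finset.card_range, nsmul_eq_mul]
        intro T hT
        rw [hind.measure_inter_preimage_eq_mul T (sets := fun _ => C k) fun _ _ => hC k,
          Finset.prod_congr rfl (g := fun _ => ν (C k)), Finset.prod_const,
          (Finset.mem_powersetCard.1 hT).2]
        intro i _
        rw [← hlaw i, Measure.map_apply (hX i) (hC k)]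
    _ ≤ ∑' k, (n.choose (s + 1) : ℝ≥0∞) * ENNReal.ofReal (2 * V * w) ^ s * ν (C k) := by
        refine ENNReal.tsum_le_tsum fun k => ?_
        rw [pow_succ, ← mul_assoc]
        gcongr
        exact hνC k
    _ ≤ (n.choose (s + 1) : ℝ≥0∞) * ENNReal.ofReal (2 * V * w) ^ s * 2 := by
        rw [ENNReal.tsum_mul_left]
        gcongr
        exact tsum_measure_Ico_le ν hw
    _ = _ := by
        have hq : 0 ≤ 2 * V * w := by positivity
        generalize 2 * V * w = q at hq
        rw [mul_comm (2 : ℝ) (_ * _), ENNReal.ofReal_mul (by positivity),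
          ENNReal.ofReal_mul (by positivity), ENNReal.ofReal_pow (by positivity),
          ENNReal.ofReal_natCast, ENNReal.ofReal_ofNat]

lemma ae_eventually_notMem_of_le_div_sq {s : ℕ → Set Ω} {C : ℝ}
    (h : ∀ n : ℕ, 1 ≤ n → P (s n) ≤ ENNReal.ofReal (C / (n : ℝ) ^ 2)) :
    ∀ᵐ ω ∂P, ∀ᶠ n in atTop, ω ∉ s n := by
  have hs : Summable fun n : ℕ => C / ((n + 1 : ℕ) : ℝ) ^ 2 := by
    have := (summable_nat_add_iff 1).2 (Real.summable_nat_pow_inv.2 (one_lt_two))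
    simpa [div_eq_mul_inv] using this.mul_left C
  have h1 : ∑' n, P (s (n + 1)) ≠ ⊤ :=
    ne_top_of_le_ne_top hs.tsum_ofReal_ne_top
      (ENNReal.tsum_le_tsum fun n => h (n + 1) (by omega))
  filter_upwards [ae_eventually_notMem h1] with ω hω
  obtain ⟨N, hN⟩ := eventually_atTop.1 hω
  refine eventually_atTop.2 ⟨N + 1, fun n hn => ?_⟩
  obtain ⟨k, rfl⟩ : ∃ k, n = k + 1 := ⟨n - 1, by omega⟩
  exact hN k (by omega)

/-- Eventually no two of the first `n` terms of `x` lie within distance `n⁻⁴` of each other. -/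
def EventuallySeparated (x : ℕ → ℝ) : Prop :=
  ∀ᶠ n : ℕ in atTop, ∀ a,
    ((Finset.range n).filter fun i => x i ∈ Set.Icc a (a + 1 / (n : ℝ) ^ 4)).card ≤ 1

/-- Eventually every interval of length `n^(-1/2)` contains at most `B n^(1/2)` of the first `n`
terms of `x`. -/
def EventuallySpread (B : ℝ) (x : ℕ → ℝ) : Prop :=
  ∀ᶠ n : ℕ in atTop, ∀ a,
    (((Finset.range n).filter fun i => x i ∈ Set.Icc a (a + 1 / √(n : ℝ))).card : ℝ) ≤ B * √n

lemma ae_eventuallySeparated [IsProbabilityMeasure ν] (hX : ∀ i, Measurable (X i))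
    (hind : iIndepFun X P) (hlaw : ∀ i, P.map (X i) = ν) {V : ℝ} (hV : 0 ≤ V)
    (hνV : ∀ S, ν S ≤ ENNReal.ofReal V * volume S) :
    ∀ᵐ ω ∂P, EventuallySeparated fun i => X i ω := by
  have h := ae_eventually_notMem_of_le_div_sq (P := P) (C := 4 * V) (s := fun n : ℕ =>
    {ω | ∃ a, 1 + 1 ≤ ((Finset.range n).filter fun i =>
      X i ω ∈ Set.Icc a (a + 1 / (n : ℝ) ^ 4)).card}) fun n hn => by
    have hn0 : (0 : ℝ) < n := by exact_mod_cast hn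
    refine (measure_exists_crowded_le hX hind hlaw hV hνV (by positivity) n 1).trans
      (ENNReal.ofReal_le_ofReal ?_)
    have hc : (n.choose (1 + 1) : ℝ) ≤ (n : ℝ) ^ 2 := by exact_mod_cast Nat.choose_le_pow n 2
    calc _ ≤ 2 * ((n : ℝ) ^ 2 * (2 * V * (1 / (n : ℝ) ^ 4)) ^ 1) := by gcongr
      _ = _ := by field_simp; ring
  filter_upwards [h] with ω hω
  filter_upwards [hω] with n hn a
  by_contra hcon
  exact hn ⟨a, by omega⟩

lemma ae_eventuallySpread [IsProbabilityMeasure ν] (hX : ∀ i, Measurable (X i))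
    (hind : iIndepFun X P) (hlaw : ∀ i, P.map (X i) = ν) {V : ℝ} (hV : 0 < V)
    (hνV : ∀ S, ν S ≤ ENNReal.ofReal V * volume S) :
    ∀ᵐ ω ∂P, EventuallySpread (2 * Real.exp 1 * V + 1) fun i => X i ω := by
  set B := 2 * Real.exp 1 * V + 1 with hB
  have hBpos : 0 < B := by positivity
  -- The threshold is written as a predecessor plus one to match `measure_exists_crowded_le`; the
  -- ceiling is positive, so nothing is truncated.
  have h := ae_eventually_notMem_of_le_div_sq (P := P) (C := 120 / V) (s := fun n : ℕ =>
    {ω | ∃ a, (⌈B * √n⌉₊ - 1) + 1 ≤ ((Finset.range n).filter fun i =>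
      X i ω ∈ Set.Icc a (a + 1 / √(n : ℝ))).card}) fun n hn => by
    have hn0 : (0 : ℝ) < n := by exact_mod_cast hn
    have hr : 0 < √(n : ℝ) := Real.sqrt_pos.2 hn0
    have hrr : √(n : ℝ) ^ 2 = n := Real.sq_sqrt hn0.le
    refine (measure_exists_crowded_le hX hind hlaw hV.le hνV (by positivity) n _).trans
      (ENNReal.ofReal_le_ofReal ?_)
    set t := ⌈B * √n⌉₊ with ht
    have ht1 : t - 1 + 1 = t := Nat.sub_add_cancel (Nat.ceil_pos.2 (by positivity))
    set r := √(n : ℝ) with hrdef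
    have hbt : B * r ≤ t := Nat.le_ceil _
    rw [ht1]
    have hc : (n.choose t : ℝ) ≤ (n : ℝ) ^ t / t.factorial := Nat.choose_le_pow_div t n
    have hpow : (2 * V * (1 / r)) ^ (t - 1) * (2 * V * (1 / r)) = (2 * V * (1 / r)) ^ t := by
      rw [← pow_succ, ht1]
    have hpow' : (2 * V * (1 / r)) ^ (t - 1) = (2 * V * (1 / r)) ^ t * (r / (2 * V)) := by
      rw [← hpow]; field_simp
    have he : (Real.exp 1 * (2 * V * r)) ^ t / t.factorial ≤ Real.exp (Real.exp 1 * (2 * V * r)) :=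
      Real.pow_div_factorial_le_exp _ (by positivity) t
    -- The value of `B` is chosen here: `t ≥ B r = e · 2Vr + r`, so the factor `exp (-t)` leaves
    -- `exp (-r)`.
    have he2 : (2 * V * r) ^ t / t.factorial ≤ Real.exp (-r) := by
      rw [mul_pow, mul_div_assoc, ← Real.exp_nat_mul, mul_one] at he
      have : (2 * V * r) ^ t / t.factorial ≤ Real.exp (Real.exp 1 * (2 * V * r)) / Real.exp t := by
        rw [le_div_iff₀ (Real.exp_pos _)]; linarith
      refine this.trans ?_
      rw [← Real.exp_sub]
      refine Real.exp_le_exp.2 ?_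
      have : B * r = Real.exp 1 * (2 * V * r) + r := by rw [hB]; ring
      linarith
    -- The fifth power is what is needed: the remaining factor `r / V` leaves `r ^ (-4) = n ^ (-2)`,
    -- and `120 = 5!`.
    have he3 : Real.exp (-r) ≤ 120 / r ^ 5 := by
      have := Real.pow_div_factorial_le_exp r hr.le 5
      rw [Real.exp_neg, inv_eq_one_div, div_le_div_iff₀ (Real.exp_pos _) (by positivity)]
      norm_num [Nat.factorial] at this
      linarith
    calc _ ≤ 2 * ((n : ℝ) ^ t / t.factorial * ((2 * V * (1 / r)) ^ t * (r / (2 * V)))) := by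
          rw [hpow']; gcongr
      _ = (2 * V * r) ^ t / t.factorial * (r / V) := by
          have : (n : ℝ) ^ t * (2 * V * (1 / r)) ^ t = (2 * V * r) ^ t := by
            rw [← mul_pow, ← hrr]; congr 1; field_simp
          rw [← this]; field_simp
      _ ≤ 120 / r ^ 5 * (r / V) :=
          mul_le_mul_of_nonneg_right (he2.trans he3) (by positivity)
      _ = _ := by rw [← hrr]; field_simp
  filter_upwards [h] with ω hω
  filter_upwards [hω, eventually_ge_atTop 1] with n hn hn1 a
  by_contra hcon
  have hr : 0 < √(n : ℝ) := Real.sqrt_pos.2 (by exact_mod_cast hn1)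
  refine hn ⟨a, ?_⟩
  rw [Nat.sub_add_cancel (Nat.ceil_pos.2 (by positivity))]
  exact Nat.ceil_le.2 (not_le.1 hcon).le

end Sample

/-! ### Likelihood gained by a spike, balanced against the reward. -/

lemma EventuallySpread.card_le {B : ℝ} {x : ℕ → ℝ} (h : EventuallySpread B x) :
    ∀ᶠ n : ℕ in atTop, ∀ μ w : ℝ, 0 ≤ w →
      (((Finset.range n).filter fun i => |x i - μ| ≤ w).card : ℝ) ≤ B * (2 * w * n + √n) := by
  filter_upwards [h, eventually_ge_atTop 1] with n hn hn1 μ w hw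
  have hn0 : (0 : ℝ) < n := by exact_mod_cast hn1
  have hr : 0 < √(n : ℝ) := Real.sqrt_pos.2 hn0
  have hrr : √(n : ℝ) ^ 2 = n := Real.sq_sqrt hn0.le
  set r := √(n : ℝ)
  have hB : 0 ≤ B * r := (Nat.cast_nonneg _).trans (hn 0)
  -- This many windows of length `n^(-1/2)` cover an interval of length `2w`.
  set K := ⌊2 * w * r⌋₊ + 1
  have hsub : ((Finset.range n).filter fun i => |x i - μ| ≤ w) ⊆
      (Finset.range K).biUnion fun j => (Finset.range n).filter fun i =>
        x i ∈ Set.Icc (μ - w + j * (1 / r)) (μ - w + j * (1 / r) + 1 / r) := by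
    intro i hi
    obtain ⟨hi, hxi⟩ := Finset.mem_filter.1 hi
    obtain ⟨h1, h2⟩ := abs_le.1 hxi
    simp only [Finset.mem_biUnion, Finset.mem_filter, Finset.mem_range]
    have hy : 0 ≤ (x i - (μ - w)) * r := mul_nonneg (by linarith) hr.le
    refine ⟨⌊(x i - (μ - w)) * r⌋₊, ?_, Finset.mem_range.1 hi, ?_, ?_⟩
    · exact Nat.lt_succ_of_le (Nat.floor_le_floor (mul_le_mul_of_nonneg_right (by linarith) hr.le))
    · have := Nat.floor_le hy
      rw [mul_one_div]
      have := (div_le_iff₀ hr).2 this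
      linarith
    · have := (Nat.lt_floor_add_one ((x i - (μ - w)) * r)).le
      rw [mul_one_div, add_assoc, ← add_div]
      have := (le_div_iff₀ hr).2 this
      linarith
  calc (((Finset.range n).filter fun i => |x i - μ| ≤ w).card : ℝ)
      ≤ ∑ j ∈ Finset.range K, (((Finset.range n).filter fun i =>
        x i ∈ Set.Icc (μ - w + j * (1 / r)) (μ - w + j * (1 / r) + 1 / r)).card : ℝ) := by
        exact_mod_cast (Finset.card_le_card hsub).trans Finset.card_biUnion_le
    _ ≤ ∑ j ∈ Finset.range K, B * r := Finset.sum_le_sum fun j _ => hn _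
    _ = K * (B * r) := by simp
    _ ≤ (2 * w * r + 1) * (B * r) := by
        gcongr
        have := Nat.floor_le (show 0 ≤ 2 * w * r by positivity)
        simp only [K]; push_cast; linarith
    _ = _ := by rw [← hrr]; ring

/-- The excess of a component with scale at most `c` near its location. -/
noncomputable def spike (v b c μ σ x : ℝ) : ℝ :=
  if σ ≤ c ∧ |x - μ| ≤ σ ^ b then v / σ else 0

lemma spike_nonneg {v b c μ σ : ℝ} (hv : 0 ≤ v) (hσ : 0 < σ) (x : ℝ) : 0 ≤ spike v b c μ σ x := by
  unfold spike
  split_ifs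
  · positivity
  · exact le_rfl

lemma eventually_mul_rpow_le (C : ℝ) {p ε : ℝ} (hp : p < 1) (hε : 0 < ε) :
    ∀ᶠ n : ℕ in atTop, C * (n : ℝ) ^ p ≤ ε * n := by
  have h1 : Tendsto (fun n : ℕ => C * (n : ℝ) ^ (-(1 - p))) atTop (𝓝 (C * 0)) :=
    ((tendsto_rpow_neg_atTop (by linarith : 0 < 1 - p)).comp
      tendsto_natCast_atTop_atTop).const_mul C
  rw [mul_zero] at h1
  filter_upwards [h1.eventually (gt_mem_nhds hε), eventually_ge_atTop 1] with n hn hn1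
  have hn0 : (0 : ℝ) < n := by exact_mod_cast hn1
  have h2 : (n : ℝ) ^ p = (n : ℝ) ^ (-(1 - p)) * n := by
    nth_rw 3 [← Real.rpow_one (n : ℝ)]
    rw [← Real.rpow_add hn0]
    congr 1
    ring
  rw [h2, ← mul_assoc]
  exact mul_le_mul_of_nonneg_right hn.le hn0.le

lemma eventually_le_exp_mul (C : ℝ) {ε : ℝ} (hε : 0 < ε) :
    ∀ᶠ n : ℕ in atTop, C ≤ Real.exp (ε * n) := by
  filter_upwards [eventually_mul_rpow_le C (p := 0) one_pos hε] with n hn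
  rw [Real.rpow_zero, mul_one] at hn
  linarith [Real.add_one_le_exp (ε * n)]

lemma exists_rpow_le {p e : ℝ} (hp : 0 < p) (he : 0 < e) :
    ∃ c > 0, c ≤ 1 ∧ ∀ σ, 0 < σ → σ ≤ c → σ ^ p ≤ e := by
  refine ⟨min 1 (e ^ p⁻¹), lt_min one_pos (Real.rpow_pos_of_pos he _), min_le_left _ _,
    fun σ hσ hσc => ?_⟩
  calc σ ^ p ≤ (e ^ p⁻¹) ^ p :=
        Real.rpow_le_rpow hσ.le (hσc.trans (min_le_right _ _)) hp.le
    _ = e := Real.rpow_inv_rpow he.le hp.ne'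

lemma prod_one_add_spike {v b c μ σ κ : ℝ} (x : ℕ → ℝ) (n : ℕ) (hσc : σ ≤ c) :
    ∏ i ∈ Finset.range n, (1 + spike v b c μ σ (x i) / κ) =
      (1 + v / σ / κ) ^ ((Finset.range n).filter fun i => |x i - μ| ≤ σ ^ b).card := by
  rw [← Finset.prod_const, Finset.prod_filter]
  refine Finset.prod_congr rfl fun i _ => ?_
  unfold spike
  by_cases h : |x i - μ| ≤ σ ^ b <;> simp [h, hσc]

/-- Two regimes for scales at most `c`. When the spike interval is shorter than `n⁻⁴`, it holds at
most one observation and the reward cancels the single factor `1 / σ`. Otherwise `σ` is at least a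
fixed power of `n`, and the count times `log (1 / σ)` is at most a small multiple of `n` plus
`O(n^(3/4))`. The cutoff `c` does not depend on the sample. -/
lemma exists_prod_spike_mul_le {M : ℕ} (hM : 1 ≤ M) {sbar : ℕ → ℝ → ℝ} (h_bdd : RewardBounded sbar)
    (h_decay : RewardDecay M sbar) {v b κ B ε : ℝ} (hv : 0 ≤ v) (hb : 0 < b) (hκ : 0 < κ)
    (hB : 0 ≤ B) (hε : 0 < ε) :
    ∃ c > 0, ∀ x : ℕ → ℝ, EventuallySeparated x → EventuallySpread B x → ∀ᶠ n : ℕ in atTop,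
      ∀ μ σ : ℝ, 0 < σ →
        (∏ i ∈ Finset.range n, (1 + spike v b c μ σ (x i) / κ)) * sbar n σ ≤ Real.exp (ε * n) := by
  obtain ⟨S, hS⟩ := h_bdd
  obtain ⟨s, hs0, d, hd0, hd1, hs⟩ := h_decay
  -- The exponent `a = b / 16` turns `σ ^ b ≳ n⁻⁴` into `σ ^ (-a) ≲ n^(1/4)`; with the `√n` from the
  -- count this gives `n^(3/4)`. The constant `D` comes from `log y ≤ y ^ a / a`, and `c` makes the
  -- linear term `2BDσ^(b-a) n` at most `ε n / 3`.
  set u := v / κ with hu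
  have hu0 : 0 ≤ u := by positivity
  set a := b / 16 with ha
  have ha0 : 0 < a := by positivity
  set D := (1 + u) ^ a / a with hD
  have hD0 : 0 ≤ D := by positivity
  have he : 0 < ε / 3 / (B * D * 2 + 1) := by positivity
  obtain ⟨c, hc0, hc1, hc⟩ := exists_rpow_le (show 0 < b - a by rw [ha]; linarith) he
  refine ⟨c, hc0, fun x hx1 hx2 => ?_⟩
  filter_upwards [hx1, hx2.card_le, eventually_ge_atTop 1,
    eventually_le_exp_mul S (ε := ε / 3) (by positivity), eventually_le_exp_mul S hε,
    eventually_mul_rpow_le (B * D * 2) (p := 3 / 4) (ε := ε / 3) (by norm_num) (by positivity),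
    eventually_le_exp_mul ((1 + u) * s) (ε := ε / 2) (by positivity),
    eventually_mul_rpow_le 1 (ε := ε / 2) hd1 (by positivity)]
    with n hsep hspr hn1 hS1 hS2 h34 hus hnd μ σ hσ
  have hn0 : (0 : ℝ) < n := by exact_mod_cast hn1
  obtain ⟨hsb0, hsbS⟩ := (hS n hn1).1 σ hσ
  by_cases hσc : σ ≤ c
  swap
  -- Above the cutoff the spike is zero and only the bounded reward remains.
  · simpa [spike, hσc] using hsbS.trans hS2
  rw [prod_one_add_spike x n hσc]
  have hσ1 : σ ≤ 1 := hσc.trans hc1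
  have hvσ : v / σ / κ = u / σ := by rw [hu]; field_simp
  rw [hvσ]
  have hbase : 1 ≤ 1 + u / σ := by linarith [show 0 ≤ u / σ by positivity]
  have hσb : 0 < σ ^ b := Real.rpow_pos_of_pos hσ b
  by_cases hcase : 2 * σ ^ b ≤ 1 / (n : ℝ) ^ 4
  · have hcard : ((Finset.range n).filter fun i => |x i - μ| ≤ σ ^ b).card ≤ 1 := by
      refine le_trans (Finset.card_le_card fun i hi => ?_) (hsep (μ - σ ^ b))
      obtain ⟨hi, hxi⟩ := Finset.mem_filter.1 hi
      obtain ⟨h1, h2⟩ := abs_le.1 hxi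
      exact Finset.mem_filter.2 ⟨hi, by linarith, by linarith⟩
    have hsσ : sbar n σ ≤ s * Real.exp ((n : ℝ) ^ d) * σ := by
      have h1 := (hs n hn1).2 σ hσ
      rw [div_le_iff₀ (by positivity)] at h1
      refine h1.trans (mul_le_mul_of_nonneg_left ?_ (by positivity))
      calc σ ^ M ≤ σ ^ 1 := pow_le_pow_of_le_one hσ.le hσ1 hM
        _ = σ := pow_one σ
    calc _ ≤ (1 + u / σ) ^ 1 * (s * Real.exp ((n : ℝ) ^ d) * σ) :=
          mul_le_mul (pow_le_pow_right₀ hbase hcard) hsσ hsb0 (by positivity)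
      _ = (σ + u) * s * Real.exp ((n : ℝ) ^ d) := by field_simp
      _ ≤ (1 + u) * s * Real.exp ((n : ℝ) ^ d) := by gcongr
      _ ≤ Real.exp (ε / 2 * n) * Real.exp (ε / 2 * n) := by
          gcongr
          linarith
      _ = Real.exp (ε * n) := by rw [← Real.exp_add]; congr 1; ring
  · set N := ((Finset.range n).filter fun i => |x i - μ| ≤ σ ^ b).card with hN
    have hNle : (N : ℝ) ≤ B * (2 * σ ^ b * n + √n) := hspr μ (σ ^ b) hσb.le
    have hlog : Real.log (1 + u / σ) ≤ D * σ ^ (-a) := by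
      calc Real.log (1 + u / σ) ≤ Real.log ((1 + u) / σ) := by
            refine Real.log_le_log (by positivity) ?_
            rw [add_div]
            have : 1 ≤ 1 / σ := by rw [le_div_iff₀ hσ]; linarith
            linarith
        _ ≤ ((1 + u) / σ) ^ a / a := Real.log_le_rpow_div (by positivity) ha0
        _ = D * σ ^ (-a) := by
            rw [Real.div_rpow (by positivity) hσ.le, Real.rpow_neg hσ.le, hD]
            field_simp
    have hσa : σ ^ (-a) ≤ 2 * (n : ℝ) ^ (1 / 4 : ℝ) := by
      have h1 : 1 / (2 * (n : ℝ) ^ 4) ≤ σ ^ b := by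
        have h2 : 1 / (2 * (n : ℝ) ^ 4) = 1 / (n : ℝ) ^ 4 / 2 := by field_simp
        rw [h2]; linarith [not_le.1 hcase]
      calc σ ^ (-a) = (σ ^ b) ^ (-(1 / 16) : ℝ) := by
            rw [← Real.rpow_mul hσ.le]; congr 1; rw [ha]; ring
        _ ≤ (1 / (2 * (n : ℝ) ^ 4)) ^ (-(1 / 16) : ℝ) :=
            Real.rpow_le_rpow_of_nonpos (by positivity) h1 (by norm_num)
        _ = (2 * (n : ℝ) ^ 4) ^ (1 / 16 : ℝ) := by
            rw [one_div, Real.inv_rpow (by positivity), ← Real.rpow_neg (by positivity), neg_neg]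
        _ = 2 ^ (1 / 16 : ℝ) * (n : ℝ) ^ (1 / 4 : ℝ) := by
            rw [Real.mul_rpow (by norm_num) (by positivity), ← Real.rpow_natCast,
              ← Real.rpow_mul hn0.le]
            norm_num
        _ ≤ 2 * (n : ℝ) ^ (1 / 4 : ℝ) := by
            gcongr
            calc (2 : ℝ) ^ (1 / 16 : ℝ) ≤ 2 ^ (1 : ℝ) :=
                  Real.rpow_le_rpow_of_exponent_le (by norm_num) (by norm_num)
              _ = 2 := Real.rpow_one 2
    have hmain : N * Real.log (1 + u / σ) ≤ ε / 3 * n + ε / 3 * n := by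
      have hprod : σ ^ b * σ ^ (-a) = σ ^ (b - a) := by
        rw [← Real.rpow_add hσ]; rfl
      have hsq : √(n : ℝ) * (n : ℝ) ^ (1 / 4 : ℝ) = (n : ℝ) ^ (3 / 4 : ℝ) := by
        rw [Real.sqrt_eq_rpow, ← Real.rpow_add hn0]; norm_num
      have h1 : B * D * 2 * σ ^ (b - a) ≤ ε / 3 := by
        have := hc σ hσ hσc
        rw [le_div_iff₀ (by positivity)] at this
        linarith [Real.rpow_pos_of_pos hσ (b - a)]
      calc N * Real.log (1 + u / σ) ≤ (B * (2 * σ ^ b * n + √n)) * (D * σ ^ (-a)) :=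
            mul_le_mul hNle hlog (Real.log_nonneg hbase) (by positivity)
        _ = B * D * 2 * (σ ^ b * σ ^ (-a)) * n + B * D * √n * σ ^ (-a) := by ring
        _ ≤ B * D * 2 * σ ^ (b - a) * n + B * D * √n * (2 * (n : ℝ) ^ (1 / 4 : ℝ)) := by
            rw [hprod]; gcongr
        _ = B * D * 2 * σ ^ (b - a) * n + B * D * 2 * (n : ℝ) ^ (3 / 4 : ℝ) := by
            rw [← hsq]; ring
        _ ≤ _ := by gcongr
    calc (1 + u / σ) ^ N * sbar n σ = Real.exp (N * Real.log (1 + u / σ)) * sbar n σ := by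
          rw [Real.exp_nat_mul, Real.exp_log (by positivity)]
      _ ≤ Real.exp (ε / 3 * n + ε / 3 * n) * Real.exp (ε / 3 * n) :=
          mul_le_mul (Real.exp_le_exp.2 hmain) (hsbS.trans hS1) hsb0 (Real.exp_pos _).le
      _ = Real.exp (ε * n) := by rw [← Real.exp_add]; congr 1; ring

/-! ### Envelopes for the components along an ultrafilter. -/

section Domination

variable {M : ℕ} {f : Fin M → ℝ → ℝ}

/-- The parameter whose mixture is the single density `f m` at location `μ` and scale `σ`. -/
def pureParam (m : Fin M) (μ σ : ℝ) : Param M := fun j => (if j = m then 1 else 0, μ, σ)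

lemma pureParam_mem (m : Fin M) (μ : ℝ) {σ : ℝ} (hσ : 0 < σ) : pureParam m μ σ ∈ paramSpace M := by
  refine ⟨fun j => ?_, ?_, fun j => hσ⟩
  · simp only [weight, pureParam]; split_ifs <;> norm_num
  · simp [weight, pureParam]

lemma mixture_pureParam (m : Fin M) (μ σ x : ℝ) :
    mixture f (pureParam m μ σ) x = locScale (f m) μ σ x := by
  simp [mixture, weight, pureParam, loc, scale]

lemma dist_pureParam_le (m : Fin M) {μ σ μ' σ' ρ : ℝ} (hρ : 0 ≤ ρ) (hμ : |μ' - μ| ≤ ρ)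
    (hσ : |σ' - σ| ≤ ρ) : dist (pureParam m μ' σ') (pureParam m μ σ) ≤ ρ := by
  rw [dist_pi_le_iff hρ]
  intro j
  simp only [pureParam, Prod.dist_eq, dist_self, Real.dist_eq, max_le_iff]
  exact ⟨hρ, hμ, hσ⟩

lemma abs_scale_sub_le (θ θ' : Param M) (m : Fin M) : |scale θ m - scale θ' m| ≤ dist θ θ' := by
  have h1 := dist_le_pi_dist θ θ' m
  have h2 : dist (θ m).2.2 (θ' m).2.2 ≤ dist (θ m) (θ' m) := by
    rw [Prod.dist_eq, Prod.dist_eq (x := (θ m).2)]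
    exact (le_max_right _ _).trans (le_max_right _ _)
  exact h2.trans h1

/-- The ball stays away from zero scales, the only constraint of `Θ` that is not closed. -/
lemma isCompact_paramSpace_inter_closedBall {θ : Param M} {r : ℝ} (hr : ∀ m, r < scale θ m) :
    IsCompact (paramSpace M ∩ Metric.closedBall θ r) := by
  have h : paramSpace M ∩ Metric.closedBall θ r =
      Metric.closedBall θ r ∩ ({θ' | ∀ m, 0 ≤ weight θ' m} ∩ {θ' | ∑ m, weight θ' m = 1}) := by
    ext θ'
    constructor
    · rintro ⟨h1, h2⟩
      exact ⟨h2, h1.1, h1.2.1⟩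
    · rintro ⟨h2, h1, h3⟩
      refine ⟨⟨h1, h3, fun m => ?_⟩, h2⟩
      have := (abs_le.1 ((abs_scale_sub_le θ' θ m).trans h2)).1
      linarith [hr m]
  have hw : ∀ m, Continuous fun θ' : Param M => weight θ' m := fun m =>
    continuous_fst.comp (continuous_apply m)
  rw [h]
  refine (isCompact_closedBall θ r).inter_right (IsClosed.inter ?_ ?_)
  · simp only [Set.ofPred_forall]
    exact isClosed_iInter fun m => isClosed_le continuous_const (hw m)
  · exact isClosed_eq (continuous_finsetSum _ fun m _ => hw m) continuous_const

/-- The exceptional null set does not depend on the sequence, so a sequence violating continuity may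
be chosen after `x`. -/
lemma ae_exists_mixture_le (h_cont : AEContinuousInParam f) {θ : Param M} (hθ : θ ∈ paramSpace M)
    {r : ℝ} (hr0 : 0 < r) (hr : ∀ m, r < scale θ m) :
    ∀ᵐ x, ∀ ε > 0, ∃ δ > 0, ∀ θ' ∈ paramSpace M, dist θ' θ ≤ δ →
      |mixture f θ' x - mixture f θ x| ≤ ε := by
  filter_upwards [h_cont _ Set.inter_subset_left (isCompact_paramSpace_inter_closedBall hr) θ
    ⟨hθ, Metric.mem_closedBall_self hr0.le⟩] with x hx ε hε
  by_contra hcon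
  push Not at hcon
  have hpos : ∀ j : ℕ, 0 < min r (1 / ((j : ℝ) + 1)) := fun j => lt_min hr0 (by positivity)
  choose u hu1 hu2 hu3 using fun j : ℕ => hcon _ (hpos j)
  have hlim : Tendsto u atTop (𝓝 θ) := by
    rw [tendsto_iff_dist_tendsto_zero]
    exact squeeze_zero (fun _ => dist_nonneg) (fun j => (hu2 j).trans (min_le_right _ _))
      tendsto_one_div_add_atTop_nhds_zero_nat
  have h1 := hx u (fun j => ⟨hu1 j, (hu2 j).trans (min_le_left _ _)⟩) hlim
  obtain ⟨j, hj⟩ := (h1.eventually (Metric.ball_mem_nhds _ hε)).exists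
  exact (hu3 j).not_ge (le_of_lt hj)

/-- The regularity assumptions concern mixtures; they are applied at `pureParam m μ σ`, whose
mixture is the single component. The envelopes are suprema over balls shrinking to that parameter,
with radii at most `σ / 4` so that scales stay bounded below. -/
lemma exists_locScale_envelope (hf : ∀ m, IsDensity (f m)) (h_meas : SupMeasurable f)
    (h_cont : AEContinuousInParam f) {v : ℝ} (hv0 : 0 ≤ v) (hv : ∀ m x, f m x ≤ v) (m : Fin M)
    (μ : ℝ) {σ : ℝ} (hσ : 0 < σ) :
    ∃ e : ℕ → ℝ → ℝ, (∀ k, AEMeasurable (e k)) ∧ (∃ C, ∀ k x, e k x ≤ C) ∧ (∀ k x, 0 ≤ e k x) ∧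
      (∀ᵐ x, Tendsto (fun k => e k x) atTop (𝓝 (locScale (f m) μ σ x))) ∧
      ∀ k, ∃ ρ > 0, ∀ μ' σ', |μ' - μ| ≤ ρ → |σ' - σ| ≤ ρ → ∀ x,
        locScale (f m) μ' σ' x ≤ e k x := by
  set θ := pureParam m μ σ with hθdef
  have hθ : θ ∈ paramSpace M := pureParam_mem m μ hσ
  obtain ⟨ρ₀, hρ₀, hmeas⟩ := h_meas θ hθ
  set r := min ρ₀ (σ / 2) with hr
  have hr0 : 0 < r := lt_min hρ₀ (by positivity)
  have hrσ : r ≤ σ / 2 := min_le_right _ _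
  let ρ : ℕ → ℝ := fun k => r / 2 * (1 / ((k : ℝ) + 1))
  have hρpos : ∀ k, 0 < ρ k := fun k => by positivity
  have hρle : ∀ k, ρ k ≤ r / 2 := fun k => by
    refine mul_le_of_le_one_right (by positivity) ?_
    rw [div_le_one (by positivity)]
    linarith [show (0 : ℝ) ≤ k by positivity]
  have hρlim : Tendsto ρ atTop (𝓝 0) := by
    simpa [ρ] using (tendsto_one_div_add_atTop_nhds_zero_nat (𝕜 := ℝ)).const_mul (r / 2)
  set C := (M : ℝ) * (v / (σ / 2)) with hC
  have hbd : ∀ k, ∀ θ' ∈ paramSpace M ∩ Metric.closedBall θ (ρ k), ∀ x, mixture f θ' x ≤ C := by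
    rintro k θ' ⟨h1, h2⟩ x
    refine (mixture_le_sum_div hv hv0 h1 x).trans ?_
    calc ∑ j, v / scale θ' j ≤ ∑ _j : Fin M, v / (σ / 2) := by
          refine Finset.sum_le_sum fun j _ => ?_
          have h3 := (abs_le.1 ((abs_scale_sub_le θ' θ j).trans h2)).1
          have h4 : scale θ j = σ := rfl
          gcongr
          linarith [hρle k]
      _ = C := by simp [hC]
  have hsup : ∀ k x, supMixture f θ (ρ k) x ≤ ENNReal.ofReal C := fun k x =>
    iSup₂_le fun θ' hθ' => ENNReal.ofReal_le_ofReal (hbd k θ' hθ' x)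
  have hdom : ∀ k, ∀ θ' ∈ paramSpace M ∩ Metric.closedBall θ (ρ k), ∀ x,
      mixture f θ' x ≤ (supMixture f θ (ρ k) x).toReal := fun k θ' hθ' x => by
    refine (ENNReal.ofReal_le_iff_le_toReal (ne_top_of_le_ne_top ENNReal.ofReal_ne_top
      (hsup k x))).1 ?_
    exact le_iSup₂ (f := fun θ' (_ : θ' ∈ paramSpace M ∩ Metric.closedBall θ (ρ k)) =>
      ENNReal.ofReal (mixture f θ' x)) θ' hθ'
  refine ⟨fun k x => (supMixture f θ (ρ k) x).toReal, fun k => ?_, ⟨C, fun k x => ?_⟩,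
    fun k x => ENNReal.toReal_nonneg, ?_, fun k => ⟨ρ k, hρpos k, fun μ' σ' h1 h2 x => ?_⟩⟩
  · refine (hmeas (ρ k) (hρpos k) ?_).ennreal_toReal
    linarith [hρle k, min_le_left ρ₀ (σ / 2)]
  · exact ENNReal.toReal_le_of_le_ofReal (by positivity) (hsup k x)
  · have hrs : ∀ j, r < scale θ j := fun j => by
      change r < σ
      linarith
    filter_upwards [ae_exists_mixture_le h_cont hθ hr0 hrs] with x hx
    rw [Metric.tendsto_atTop']
    intro ε hε
    obtain ⟨δ, hδ, h⟩ := hx (ε / 2) (by positivity)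
    obtain ⟨K, hK⟩ := eventually_atTop.1 (hρlim.eventually (gt_mem_nhds hδ))
    refine ⟨K, fun k hk => ?_⟩
    have h1 := hdom k θ ⟨hθ, Metric.mem_closedBall_self (hρpos k).le⟩ x
    rw [hθdef, mixture_pureParam] at h1
    have hval : 0 ≤ locScale (f m) μ σ x := locScale_nonneg (hf m).1 hσ x
    have h2 : (supMixture f θ (ρ k) x).toReal ≤ locScale (f m) μ σ x + ε / 2 := by
      refine ENNReal.toReal_le_of_le_ofReal (by positivity) (iSup₂_le fun θ' hθ' =>
        ENNReal.ofReal_le_ofReal ?_)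
      have h3 := (abs_le.1 (h θ' hθ'.1 (hθ'.2.trans (hK k hk.le).le))).2
      rw [hθdef, mixture_pureParam] at h3
      linarith
    rw [Real.dist_eq, abs_of_nonneg (by linarith)]
    linarith
  · have hσ' : 0 < σ' := by linarith [(abs_le.1 h2).1, hρle k]
    have := hdom k (pureParam m μ' σ')
      ⟨pureParam_mem m μ' hσ', dist_pureParam_le m (hρpos k).le h1 h2⟩ x
    rwa [mixture_pureParam] at this

/-- Along the ultrafilter `F`, the `m`-th weighted component is dominated, up to a spike of
arbitrarily small scale, by a bounded sequence converging to `a * locScale (f m) μ σ`. -/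
structure ComponentEnvelope (f : Fin M → ℝ → ℝ) (F : Ultrafilter (Param M)) (v b : ℝ) (m : Fin M)
    (a μ σ : ℝ) (e : ℕ → ℝ → ℝ) : Prop where
  aemeasurable : ∀ k, AEMeasurable (e k)
  bounded : ∃ C, ∀ k x, e k x ≤ C
  nonneg : ∀ k x, 0 ≤ e k x
  tendsto : ∀ᵐ x, Tendsto (fun k => e k x) atTop (𝓝 (a * locScale (f m) μ σ x))
  le : ∀ k, ∀ c > 0, ∀ᶠ θ in F, ∀ x, weight θ m * locScale (f m) (loc θ m) (scale θ m) x ≤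
    e k x + spike v b c (loc θ m) (scale θ m) x

lemma weight_mul_locScale_le (hf : ∀ m, IsDensity (f m)) {θ : Param M} (hθ : θ ∈ paramSpace M)
    (m : Fin M) (x : ℝ) : weight θ m * locScale (f m) (loc θ m) (scale θ m) x ≤
      locScale (f m) (loc θ m) (scale θ m) x :=
  mul_le_of_le_one_left (locScale_nonneg (hf m).1 (hθ.2.2 m) x) (weight_le_one hθ m)

/-- Outside the spike the tail bound gives `v₁ σ^(β-1) σ^(-bβ)`. The choice `b = (β - 1) / (2β)`
makes this `v₁ σ^((β-1)/2)`, which still tends to zero. The limit has weight zero, so its location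
`0` and scale `1` are placeholders. -/
lemma componentEnvelope_of_scale_tendsto_zero (hf : ∀ m, IsDensity (f m)) {v v₁ β : ℝ}
    (hv : ∀ m x, f m x ≤ v) (hv₁ : 0 < v₁) (hβ : 1 < β)
    (htail : ∀ m x, x ≠ 0 → f m x ≤ v₁ * |x| ^ (-β)) {F : Ultrafilter (Param M)}
    (hF : paramSpace M ∈ F) (m : Fin M) (h : ∀ c > 0, ∀ᶠ θ in F, scale θ m ≤ c) :
    ComponentEnvelope f F v ((β - 1) / (2 * β)) m 0 0 1 fun k _ => 1 / ((k : ℝ) + 1) where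
  aemeasurable k := aemeasurable_const
  bounded := ⟨1, fun k x => by
    rw [div_le_one (by positivity)]
    linarith [show (0 : ℝ) ≤ k by positivity]⟩
  nonneg k x := by positivity
  tendsto := by
    refine Eventually.of_forall fun x => ?_
    rw [zero_mul]
    exact tendsto_one_div_add_atTop_nhds_zero_nat
  le k c hc := by
    have hp : 0 < (β - 1) / 2 := by linarith
    obtain ⟨c', hc', -, hcle⟩ := exists_rpow_le hp (show 0 < 1 / ((k : ℝ) + 1) / v₁ by positivity)
    filter_upwards [h c hc, h c' hc', hF] with θ h1 h2 hθ x
    have hσ := hθ.2.2 m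
    refine (weight_mul_locScale_le hf hθ m x).trans ?_
    have hk : (0 : ℝ) ≤ 1 / ((k : ℝ) + 1) := by positivity
    by_cases hx : |x - loc θ m| ≤ scale θ m ^ ((β - 1) / (2 * β))
    · rw [spike, if_pos ⟨h1, hx⟩]
      linarith [locScale_le_div (hv m) hσ (μ := loc θ m) x]
    · rw [spike, if_neg fun h => hx h.2, add_zero]
      have hw : 0 < scale θ m ^ ((β - 1) / (2 * β)) := Real.rpow_pos_of_pos hσ _
      rw [not_le] at hx
      have hne : x ≠ loc θ m := by
        rintro rfl
        rw [sub_self, abs_zero] at hx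
        linarith
      calc _ ≤ v₁ * scale θ m ^ (β - 1) * |x - loc θ m| ^ (-β) :=
            locScale_le_tail (htail m) hσ hne
        _ ≤ v₁ * scale θ m ^ (β - 1) * (scale θ m ^ ((β - 1) / (2 * β))) ^ (-β) := by
            refine mul_le_mul_of_nonneg_left ?_ (by positivity)
            exact Real.rpow_le_rpow_of_nonpos hw hx.le (by linarith)
        _ = v₁ * scale θ m ^ ((β - 1) / 2) := by
            rw [← Real.rpow_mul hσ.le, mul_assoc, ← Real.rpow_add hσ]
            congr 2
            field_simp
            ring
        _ ≤ _ := by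
            have := hcle _ hσ h2
            rw [le_div_iff₀ hv₁] at this
            linarith

/-- On `|x| ≤ k` the component becomes uniformly small: a large scale flattens it, and with a
bounded scale the location is far away, so that the tail bound applies. Elsewhere the crude bound `v
/ c₀` suffices, because every point is eventually inside `|x| ≤ k`. -/
lemma componentEnvelope_of_escape (hf : ∀ m, IsDensity (f m)) {v v₁ β : ℝ}
    (hv0 : 0 < v) (hv : ∀ m x, f m x ≤ v) (hv₁ : 0 < v₁) (hβ : 1 < β)
    (htail : ∀ m x, x ≠ 0 → f m x ≤ v₁ * |x| ^ (-β)) {F : Ultrafilter (Param M)}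
    (hF : paramSpace M ∈ F) (b : ℝ) (m : Fin M) {c₀ : ℝ} (hc₀ : 0 < c₀)
    (h₀ : ∀ᶠ θ in F, c₀ ≤ scale θ m)
    (h : ∀ C, ∀ᶠ θ in F, ¬ (|loc θ m| ≤ C ∧ scale θ m ≤ C)) :
    ComponentEnvelope f F v b m 0 0 1 fun k x =>
      1 / ((k : ℝ) + 1) + if |x| ≤ k then 0 else v / c₀ where
  aemeasurable k := by
    refine aemeasurable_const.add (Measurable.aemeasurable ?_)
    exact Measurable.ite (measurableSet_le (by fun_prop) measurable_const)
      measurable_const measurable_const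
  bounded := ⟨1 + v / c₀, fun k x => by
    have h1 : 1 / ((k : ℝ) + 1) ≤ 1 := by
      rw [div_le_one (by positivity)]
      linarith [show (0 : ℝ) ≤ k by positivity]
    have h2 : 0 < v / c₀ := by positivity
    split_ifs <;> linarith⟩
  nonneg k x := by split_ifs <;> positivity
  tendsto := by
    refine Eventually.of_forall fun x => ?_
    rw [zero_mul]
    refine (tendsto_one_div_add_atTop_nhds_zero_nat (𝕜 := ℝ)).congr' ?_
    filter_upwards [eventually_ge_atTop ⌈|x|⌉₊] with k hk
    rw [if_pos ((Nat.le_ceil _).trans (by exact_mod_cast hk)), add_zero]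
  le k c hc := by
    -- A scale of at least `C₁` already forces the component below `1 / (k + 1)`; `t⁻¹` is the
    -- distance at which the tail bound does so for smaller scales.
    set C₁ := v * ((k : ℝ) + 1) with hC₁
    have hC₁0 : 0 < C₁ := by positivity
    obtain ⟨t, ht, -, htle⟩ := exists_rpow_le (show 0 < β by linarith)
      (show 0 < 1 / ((k : ℝ) + 1) / (v₁ * C₁ ^ (β - 1)) by positivity)
    filter_upwards [h (max C₁ (k + t⁻¹)), h₀, hF] with θ h1 h2 hθ x
    have hσ := hθ.2.2 m
    have hspike := spike_nonneg (b := b) (c := c) (μ := loc θ m) hv0.le hσ x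
    refine (weight_mul_locScale_le hf hθ m x).trans ?_
    have hle := locScale_le_div (hv m) hσ (μ := loc θ m) x
    have hk : (0 : ℝ) < 1 / ((k : ℝ) + 1) := by positivity
    by_cases hx : |x| ≤ k
    swap
    · rw [if_neg hx]
      have : v / scale θ m ≤ v / c₀ := by gcongr
      linarith
    rw [if_pos hx, add_zero]
    suffices hs : locScale (f m) (loc θ m) (scale θ m) x ≤ 1 / ((k : ℝ) + 1) by linarith
    by_cases hs : C₁ ≤ scale θ m
    · refine hle.trans ?_
      rw [div_le_div_iff₀ hσ (by positivity)]
      linarith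
    rw [not_le] at hs
    have hloc : k + t⁻¹ < |loc θ m| := by
      by_contra hcon
      exact h1 ⟨(not_lt.1 hcon).trans (le_max_right _ _), hs.le.trans (le_max_left _ _)⟩
    have ht' : 0 < t⁻¹ := by positivity
    have hdist : t⁻¹ ≤ |x - loc θ m| := by
      have := abs_sub_abs_le_abs_sub (loc θ m) x
      rw [abs_sub_comm]
      linarith
    have hne : x ≠ loc θ m := by
      rintro rfl
      rw [sub_self, abs_zero] at hdist
      linarith
    calc _ ≤ v₁ * scale θ m ^ (β - 1) * |x - loc θ m| ^ (-β) := locScale_le_tail (htail m) hσ hne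
      _ ≤ v₁ * C₁ ^ (β - 1) * t⁻¹ ^ (-β) := by
          have h3 : scale θ m ^ (β - 1) ≤ C₁ ^ (β - 1) :=
            Real.rpow_le_rpow hσ.le hs.le (by linarith)
          have h4 : |x - loc θ m| ^ (-β) ≤ t⁻¹ ^ (-β) :=
            Real.rpow_le_rpow_of_nonpos ht' hdist (by linarith)
          gcongr
      _ = t ^ β * (v₁ * C₁ ^ (β - 1)) := by
          rw [Real.inv_rpow ht.le, Real.rpow_neg ht.le, inv_inv]
          ring
      _ ≤ _ := (le_div_iff₀ (by positivity)).1 (htle t ht le_rfl)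

/-- The weight is eventually below `a + 1 / (k + 1)`, and the slack vanishes as `k` grows. -/
lemma exists_componentEnvelope_of_tendsto (hf : ∀ m, IsDensity (f m)) (h_meas : SupMeasurable f)
    (h_cont : AEContinuousInParam f) {v : ℝ} (hv0 : 0 ≤ v) (hv : ∀ m x, f m x ≤ v)
    {F : Ultrafilter (Param M)} (hF : paramSpace M ∈ F) (b : ℝ) (m : Fin M) {a μ σ : ℝ}
    (ha : 0 ≤ a) (hσ : 0 < σ) (h : Tendsto (fun θ : Param M => θ m) F (𝓝 (a, μ, σ))) :
    ∃ e, ComponentEnvelope f F v b m a μ σ e := by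
  obtain ⟨e, he1, ⟨C, hC⟩, he2, he3, he4⟩ := exists_locScale_envelope hf h_meas h_cont hv0 hv m μ hσ
  refine ⟨fun k x => (a + 1 / ((k : ℝ) + 1)) * e k x, fun k => (he1 k).const_mul _,
    ⟨(a + 1) * C, fun k x => ?_⟩, fun k x => mul_nonneg (by positivity) (he2 k x), ?_,
    fun k c hc => ?_⟩
  · have h1 : 1 / ((k : ℝ) + 1) ≤ 1 := by
      rw [div_le_one (by positivity)]
      linarith [show (0 : ℝ) ≤ k by positivity]
    exact mul_le_mul (by linarith) (hC k x) (he2 k x) (by linarith)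
  · filter_upwards [he3] with x hx
    have := ((tendsto_one_div_add_atTop_nhds_zero_nat (𝕜 := ℝ)).const_add a).mul hx
    rwa [add_zero] at this
  · obtain ⟨ρ, hρ, hle⟩ := he4 k
    have hk : 0 < 1 / ((k : ℝ) + 1) := by positivity
    have h1 : ∀ᶠ θ in F, weight θ m < a + 1 / ((k : ℝ) + 1) :=
      (continuous_fst.tendsto _).comp h |>.eventually (gt_mem_nhds (by simpa using hk))
    have h2 : ∀ᶠ θ in F, dist (loc θ m) μ < ρ :=
      ((continuous_fst.comp continuous_snd).tendsto _).comp h |>.eventually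
        (Metric.ball_mem_nhds _ hρ)
    have h3 : ∀ᶠ θ in F, dist (scale θ m) σ < ρ :=
      ((continuous_snd.comp continuous_snd).tendsto _).comp h |>.eventually
        (Metric.ball_mem_nhds _ hρ)
    filter_upwards [h1, h2, h3, hF] with θ h1 h2 h3 hθ x
    have hs := hθ.2.2 m
    have hspike := spike_nonneg (b := b) (c := c) (μ := loc θ m) hv0 hs x
    have := mul_le_mul h1.le (hle _ _ h2.le h3.le x) (locScale_nonneg (hf m).1 hs x)
      (by positivity)
    linarith

lemma exists_componentEnvelope (hf : ∀ m, IsDensity (f m)) (h_meas : SupMeasurable f)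
    (h_cont : AEContinuousInParam f) {v v₁ β : ℝ} (hv0 : 0 < v) (hv : ∀ m x, f m x ≤ v)
    (hv₁ : 0 < v₁) (hβ : 1 < β) (htail : ∀ m x, x ≠ 0 → f m x ≤ v₁ * |x| ^ (-β))
    {F : Ultrafilter (Param M)} (hF : paramSpace M ∈ F) (m : Fin M) :
    ∃ a μ σ e, 0 ≤ a ∧ 0 < σ ∧ ComponentEnvelope f F v ((β - 1) / (2 * β)) m a μ σ e ∧
      (a = 0 ∨ Tendsto (fun θ : Param M => θ m) F (𝓝 (a, μ, σ))) := by
  by_cases hzero : ∀ c > 0, ∀ᶠ θ in F, scale θ m ≤ c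
  · exact ⟨0, 0, 1, _, le_rfl, one_pos,
      componentEnvelope_of_scale_tendsto_zero hf hv hv₁ hβ htail hF m hzero, Or.inl rfl⟩
  -- Along an ultrafilter, failing to hold eventually means that the negation holds eventually.
  push Not at hzero
  obtain ⟨c₀, hc₀, hnot⟩ := hzero
  have hsc : ∀ᶠ θ in F, c₀ ≤ scale θ m := hnot.mono fun θ hθ => le_of_lt hθ
  by_cases hesc : ∀ C, ∀ᶠ θ in F, ¬ (|loc θ m| ≤ C ∧ scale θ m ≤ C)
  · exact ⟨0, 0, 1, _, le_rfl, one_pos,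
      componentEnvelope_of_escape hf hv0 hv hv₁ hβ htail hF _ m hc₀ hsc hesc, Or.inl rfl⟩
  push Not at hesc
  obtain ⟨C, hC⟩ := hesc
  have hK : IsCompact (Set.Icc (0 : ℝ) 1 ×ˢ (Set.Icc (-C) C ×ˢ Set.Icc c₀ C)) :=
    isCompact_Icc.prod (isCompact_Icc.prod isCompact_Icc)
  obtain ⟨⟨a, μ, σ⟩, hmem, hlim⟩ := hK.ultrafilter_le_nhds (F.map fun θ : Param M => θ m) (by
    rw [le_principal_iff]
    change ∀ᶠ θ : Param M in F, θ m ∈ Set.Icc (0 : ℝ) 1 ×ˢ (Set.Icc (-C) C ×ˢ Set.Icc c₀ C)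
    filter_upwards [hC, hsc, hF] with θ h1 h2 hθ
    exact ⟨⟨hθ.1 m, weight_le_one hθ m⟩, abs_le.1 h1.1, h2, h1.2⟩)
  have hσ : 0 < σ := hc₀.trans_le hmem.2.2.1
  obtain ⟨e, he⟩ := exists_componentEnvelope_of_tendsto hf h_meas h_cont hv0.le hv hF
    ((β - 1) / (2 * β)) m hmem.1.1 hσ hlim
  exact ⟨a, μ, σ, e, hmem.1.1, hσ, he, Or.inr hlim⟩

end Domination

/-! ### Law of large numbers for almost everywhere measurable functions. -/

section LawOfLargeNumbers

variable {Ω : Type*} [MeasurableSpace Ω] {P : Measure Ω} {X : ℕ → Ω → ℝ} {g : ℝ → ℝ}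

lemma ae_forall_of_ae_withDensity (hX : ∀ i, Measurable (X i)) {ν : Measure ℝ}
    (hlaw : ∀ i, P.map (X i) = ν) {p : ℝ → Prop} (hp : ∀ᵐ x ∂ν, p x) :
    ∀ᵐ ω ∂P, ∀ i, p (X i ω) :=
  ae_all_iff.2 fun i => ae_of_ae_map (hX i).aemeasurable (by rwa [hlaw i])

lemma tendsto_average_of_withDensity (hX : ∀ i, Measurable (X i)) (hind : iIndepFun X P)
    (hg0 : ∀ x, 0 ≤ g x) (hg : AEMeasurable g)
    (hlaw : ∀ i, P.map (X i) = volume.withDensity fun x => ENNReal.ofReal (g x))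
    {ψ : ℝ → ℝ} (hψ : AEMeasurable ψ) (hint : Integrable fun x => g x * ψ x) :
    ∀ᵐ ω ∂P, Tendsto (fun n : ℕ => (∑ i ∈ Finset.range n, ψ (X i ω)) / n) atTop
      (𝓝 (∫ x, g x * ψ x)) := by
  set ν := volume.withDensity fun x => ENNReal.ofReal (g x) with hν
  have hgm : AEMeasurable (fun x => ENNReal.ofReal (g x)) := hg.ennreal_ofReal
  have hlt : ∀ᵐ x, ENNReal.ofReal (g x) < ⊤ := Eventually.of_forall fun x => ENNReal.ofReal_lt_top
  have hreal : ∀ φ : ℝ → ℝ, (fun x => (ENNReal.ofReal (g x)).toReal • φ x) = fun x => g x * φ x :=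
    fun φ => by ext x; rw [ENNReal.toReal_ofReal (hg0 x), smul_eq_mul]
  -- The strong law is applied to a measurable modification; almost surely no observation falls
  -- where it differs from `ψ`.
  have hψν : ψ =ᵐ[ν] hψ.mk ψ := (withDensity_absolutelyContinuous _ _) hψ.ae_eq_mk
  have hintν : Integrable ψ ν := by
    rw [hν, integrable_withDensity_iff_integrable_smul₀' hgm hlt, hreal]
    exact hint
  have hmean : ∫ x, ψ x ∂ν = ∫ x, g x * ψ x := by
    rw [hν, integral_withDensity_eq_integral_toReal_smul₀ hgm hlt, hreal]
  have hmk : Measurable (hψ.mk ψ) := hψ.measurable_mk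
  have hident : ∀ i, IdentDistrib (X i) (X 0) P P := fun i =>
    ⟨(hX i).aemeasurable, (hX 0).aemeasurable, by rw [hlaw i, hlaw 0]⟩
  have hmkint : Integrable (hψ.mk ψ) (P.map (X 0)) := by
    rw [hlaw 0]
    exact hintν.congr hψν
  have hslln := strong_law_ae_real (μ := P) (fun i => hψ.mk ψ ∘ X i)
    (hmkint.comp_measurable (hX 0))
    (fun i j hij => (hind.indepFun hij).comp hmk hmk) (fun i => (hident i).comp hmk)
  have hval : ∫ ω, (hψ.mk ψ ∘ X 0) ω ∂P = ∫ x, g x * ψ x := by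
    rw [← hmean, integral_congr_ae hψν, ← hlaw 0,
      integral_map (hX 0).aemeasurable hmk.aestronglyMeasurable]
    rfl
  rw [hval] at hslln
  filter_upwards [hslln, ae_forall_of_ae_withDensity hX hlaw hψν] with ω h1 h2
  refine h1.congr fun n => ?_
  congr 1
  exact Finset.sum_congr rfl fun i _ => (h2 i).symm

end LawOfLargeNumbers

/-! ### Strict negativity of the mean log-ratio, through the Hellinger affinity. -/

section Entropy

variable {p g : ℝ → ℝ}

lemma integrable_sqrt_mul_sqrt (hp0 : ∀ x, 0 ≤ p x) (hg0 : ∀ x, 0 ≤ g x) (hp : Integrable p)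
    (hg : Integrable g) : Integrable fun x => √(p x) * √(g x) := by
  refine (hp.add hg).mono' ?_ (Eventually.of_forall fun x => ?_)
  · exact (hp.aestronglyMeasurable.aemeasurable.sqrt.mul
      hg.aestronglyMeasurable.aemeasurable.sqrt).aestronglyMeasurable
  · rw [Real.norm_eq_abs, abs_of_nonneg (by positivity), Pi.add_apply]
    nlinarith [sq_nonneg (√(p x) - √(g x)), Real.sq_sqrt (hp0 x), Real.sq_sqrt (hg0 x),
      hp0 x, hg0 x]

/-- Expand `∫ (√p - √g)²`, which is positive when the functions differ on a non-null set. -/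
lemma integral_sqrt_mul_sqrt_lt_one (hp0 : ∀ x, 0 ≤ p x) (hg0 : ∀ x, 0 ≤ g x) (hp : Integrable p)
    (hg : Integrable g) (hp1 : ∫ x, p x ≤ 1) (hg1 : ∫ x, g x ≤ 1) (hne : ¬ p =ᵐ[volume] g) :
    ∫ x, √(p x) * √(g x) < 1 := by
  have hpg := integrable_sqrt_mul_sqrt hp0 hg0 hp hg
  have hexp : ∀ x, (√(p x) - √(g x)) ^ 2 = p x + g x - 2 * (√(p x) * √(g x)) := fun x => by
    rw [sub_sq, Real.sq_sqrt (hp0 x), Real.sq_sqrt (hg0 x)]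
    ring
  have hint : Integrable fun x => (√(p x) - √(g x)) ^ 2 := by
    simp_rw [hexp]
    exact (hp.add hg).sub (hpg.const_mul 2)
  have hpos : 0 < ∫ x, (√(p x) - √(g x)) ^ 2 := by
    refine lt_of_le_of_ne (integral_nonneg fun x => sq_nonneg _) fun h0 => hne ?_
    filter_upwards [(integral_eq_zero_iff_of_nonneg (fun x => sq_nonneg _) hint).1 h0.symm]
      with x hx
    have h1 : √(p x) = √(g x) := sub_eq_zero.1 (pow_eq_zero_iff (two_ne_zero) |>.1 hx)
    rw [← Real.sq_sqrt (hp0 x), ← Real.sq_sqrt (hg0 x), h1]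
  have hval : ∫ x, (√(p x) - √(g x)) ^ 2 =
      (∫ x, p x) + (∫ x, g x) - 2 * ∫ x, √(p x) * √(g x) := by
    have hadd : Integrable fun x => p x + g x := hp.add hg
    simp_rw [hexp]
    rw [integral_sub hadd (hpg.const_mul 2), integral_add hp hg, integral_const_mul]
  linarith

/-- This combines `log u ≤ 2 (√u - 1)` with `√(max s (r² t)) ≤ √s + r √t`. The floor `r² t` keeps
the logarithm under control where `s` vanishes, at the price of the term `r t`. -/
lemma mul_log_max_sub_log_le {s t r : ℝ} (hs : 0 ≤ s) (ht : 0 ≤ t) (hr : 0 < r) :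
    t * (Real.log (max s (r ^ 2 * t)) - Real.log t) ≤ 2 * (√s * √t + r * t - t) := by
  rcases ht.eq_or_lt with rfl | ht0
  · simp
  have hmax : 0 < max s (r ^ 2 * t) := lt_max_of_lt_right (by positivity)
  set u := max s (r ^ 2 * t) / t with hu
  have hu0 : 0 < u := by positivity
  have hlog : Real.log u ≤ 2 * (√u - 1) := by
    have h1 := Real.log_le_sub_one_of_pos (Real.sqrt_pos.2 hu0)
    rw [Real.log_sqrt hu0.le] at h1
    linarith
  have hsq : t * √u ≤ √s * √t + r * t := by
    have h1 : √(max s (r ^ 2 * t)) ≤ √s + r * √t := by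
      rw [Real.sqrt_le_left (by positivity)]
      have := Real.sq_sqrt hs
      have := Real.sq_sqrt ht
      refine max_le ?_ ?_ <;> nlinarith [Real.sqrt_nonneg s, Real.sqrt_nonneg t,
        mul_nonneg (mul_nonneg hr.le (Real.sqrt_nonneg s)) (Real.sqrt_nonneg t)]
    have h2 : t * √u = √t * √(max s (r ^ 2 * t)) := by
      rw [hu, Real.sqrt_div hmax.le]
      have := Real.sqrt_pos.2 ht0
      field_simp
      rw [Real.sq_sqrt ht]
    rw [h2]
    calc √t * √(max s (r ^ 2 * t)) ≤ √t * (√s + r * √t) := by gcongr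
      _ = √s * √t + r * (√t * √t) := by ring
      _ = _ := by rw [Real.mul_self_sqrt ht]
  rw [← Real.log_div hmax.ne' ht0.ne', ← hu]
  nlinarith [mul_le_mul_of_nonneg_left hlog ht]

lemma abs_log_max_sub_log_le {s t r C : ℝ} (hsC : s ≤ C)
    (ht : 0 < t) (hr : 0 < r) (hr1 : r ≤ 1) :
    |Real.log (max s (r * t)) - Real.log t| ≤ |Real.log r| + |Real.log C| + |Real.log t| := by
  have hrt : 0 < r * t := by positivity
  have hmax : 0 < max s (r * t) := lt_max_of_lt_right hrt
  have h1 : Real.log r + Real.log t ≤ Real.log (max s (r * t)) := by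
    rw [← Real.log_mul hr.ne' ht.ne']
    exact Real.log_le_log hrt (le_max_right _ _)
  have h2 : Real.log (max s (r * t)) ≤ max (Real.log C) (Real.log t) := by
    rcases le_total s (r * t) with h | h
    · rw [max_eq_right h]
      exact (Real.log_le_log hrt (mul_le_of_le_one_left ht.le hr1)).trans (le_max_right _ _)
    · rw [max_eq_left h]
      exact (Real.log_le_log (hrt.trans_le h) hsC).trans (le_max_left _ _)
  have h3 : max (Real.log C) (Real.log t) - Real.log t ≤ |Real.log C| + |Real.log t| := by
    rcases max_cases (Real.log C) (Real.log t) with ⟨h, -⟩ | ⟨h, -⟩ <;> rw [h]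
    · linarith [le_abs_self (Real.log C), neg_abs_le (Real.log t)]
    · linarith [abs_nonneg (Real.log C), abs_nonneg (Real.log t)]
  rw [abs_le]
  constructor
  · linarith [neg_abs_le (Real.log r), abs_nonneg (Real.log C), abs_nonneg (Real.log t)]
  · linarith [abs_nonneg (Real.log r)]

lemma abs_log_le_of_mem_Icc {s a C : ℝ} (ha : 0 < a) (has : a ≤ s) (hsC : s ≤ C) :
    |Real.log s| ≤ |Real.log a| + |Real.log C| := by
  have h1 := Real.log_le_log ha has
  have h2 := Real.log_le_log (ha.trans_le has) hsC
  rw [abs_le]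
  constructor
  · linarith [neg_abs_le (Real.log a), abs_nonneg (Real.log C)]
  · linarith [le_abs_self (Real.log C), abs_nonneg (Real.log a)]

/-- If bounded positive functions `E k` converge to a subprobability density `p` different from the
density `g`, then `∫ g log (E k / g)` is negative for some `k`. -/
lemma exists_integral_mul_log_sub_log_neg (hp0 : ∀ x, 0 ≤ p x) (hg0 : ∀ x, 0 ≤ g x)
    (hp : Integrable p) (hg : Integrable g) (hp1 : ∫ x, p x ≤ 1) (hg1 : ∫ x, g x = 1)
    (hne : ¬ p =ᵐ[volume] g) (hlog : Integrable fun x => |Real.log (g x)| * g x)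
    {E : ℕ → ℝ → ℝ} (hEm : ∀ k, AEMeasurable (E k)) (hElow : ∀ k, ∃ a > 0, ∀ x, a ≤ E k x)
    {C : ℝ} (hEC : ∀ k x, E k x ≤ C)
    (hElim : ∀ᵐ x, Tendsto (fun k => E k x) atTop (𝓝 (p x))) :
    ∃ k, Integrable (fun x => g x * (Real.log (E k x) - Real.log (g x))) ∧
      ∫ x, g x * (Real.log (E k x) - Real.log (g x)) < 0 := by
  have hgm : AEMeasurable g := hg.aestronglyMeasurable.aemeasurable
  have hpg := integrable_sqrt_mul_sqrt hp0 hg0 hp hg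
  have hJ := integral_sqrt_mul_sqrt_lt_one hp0 hg0 hp hg hp1 hg1.le hne
  have hJ0 : 0 ≤ ∫ x, √(p x) * √(g x) := integral_nonneg fun x => by positivity
  set J := ∫ x, √(p x) * √(g x) with hJdef
  -- With this `r` the final bound `2 (J + r - 1)` equals `J - 1 < 0`.
  set r := (1 - J) / 2 with hr
  have hr0 : 0 < r := by rw [hr]; linarith
  have hr1 : r ^ 2 ≤ 1 := by
    have : r ≤ 1 := by rw [hr]; linarith
    nlinarith
  have hintE : ∀ k, Integrable fun x => g x * (Real.log (E k x) - Real.log (g x)) := fun k => by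
    obtain ⟨a, ha, hale⟩ := hElow k
    refine ((hg.mul_const (|Real.log a| + |Real.log C|)).add hlog).mono' ?_
      (Eventually.of_forall fun x => ?_)
    · exact (hgm.mul ((hEm k).log.sub hgm.log)).aestronglyMeasurable
    · rw [norm_mul, Real.norm_eq_abs, Real.norm_eq_abs, abs_of_nonneg (hg0 x), Pi.add_apply,
        mul_comm |Real.log (g x)|, ← mul_add]
      refine mul_le_mul_of_nonneg_left ((abs_sub _ _).trans ?_) (hg0 x)
      gcongr
      exact abs_log_le_of_mem_Icc ha (hale x) (hEC k x)
  -- The lower bounds on `E k` are not uniform in `k`. Truncating below at `r² g` gives a dominating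
  -- function independent of `k`, and only increases the integral.
  set φ : ℕ → ℝ → ℝ := fun k x => g x * (Real.log (max (E k x) (r ^ 2 * g x)) - Real.log (g x))
    with hφ
  have hφm : ∀ k, AEStronglyMeasurable (φ k) := fun k =>
    (hgm.mul (((hEm k).max (hgm.const_mul _)).log.sub hgm.log)).aestronglyMeasurable
  have hbint : Integrable fun x =>
      g x * (|Real.log (r ^ 2)| + |Real.log C|) + |Real.log (g x)| * g x :=
    (hg.mul_const _).add hlog
  have hφb : ∀ k x, ‖φ k x‖ ≤
      g x * (|Real.log (r ^ 2)| + |Real.log C|) + |Real.log (g x)| * g x := fun k x => by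
    rcases (hg0 x).eq_or_lt with h | h
    · simp [hφ, ← h]
    · rw [hφ, norm_mul, Real.norm_eq_abs, Real.norm_eq_abs, abs_of_nonneg (hg0 x),
        mul_comm |Real.log (g x)|, ← mul_add]
      exact mul_le_mul_of_nonneg_left
        (abs_log_max_sub_log_le (hEC k x) h (by positivity) hr1) (hg0 x)
  have hlim := tendsto_integral_of_dominated_convergence (F := φ)
    (f := fun x => g x * (Real.log (max (p x) (r ^ 2 * g x)) - Real.log (g x))) _ hφm hbint
    (fun k => Eventually.of_forall (hφb k)) (by
      filter_upwards [hElim] with x hx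
      rcases (hg0 x).eq_or_lt with h | h
      · simp [hφ, ← h]
      · have hmax : max (p x) (r ^ 2 * g x) ≠ 0 :=
          (lt_max_of_lt_right (by positivity : 0 < r ^ 2 * g x)).ne'
        exact (((hx.max tendsto_const_nhds).log hmax).sub_const _).const_mul _)
  have hneg : ∫ x, g x * (Real.log (max (p x) (r ^ 2 * g x)) - Real.log (g x)) < 0 := by
    have hup : Integrable fun x => 2 * (√(p x) * √(g x) + r * g x - g x) :=
      ((hpg.add (hg.const_mul r)).sub hg).const_mul 2
    have hupval : ∫ x, 2 * (√(p x) * √(g x) + r * g x - g x) = 2 * (J + r - 1) := by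
      have hadd : Integrable fun x => √(p x) * √(g x) + r * g x := hpg.add (hg.const_mul r)
      rw [integral_const_mul, integral_sub hadd hg,
        integral_add hpg (hg.const_mul r), integral_const_mul, hg1, mul_one]
    have hle : ∫ x, g x * (Real.log (max (p x) (r ^ 2 * g x)) - Real.log (g x)) ≤
        2 * (J + r - 1) := by
      rw [← hupval]
      refine integral_mono (hbint.mono' (hgm.mul ((hp.aestronglyMeasurable.aemeasurable.max
        (hgm.const_mul _)).log.sub hgm.log)).aestronglyMeasurable ?_) hup
        fun x => mul_log_max_sub_log_le (hp0 x) (hg0 x) hr0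
      filter_upwards [hElim] with x hx
      rcases (hg0 x).eq_or_lt with h | h
      · simp [← h]
      · rw [norm_mul, Real.norm_eq_abs, Real.norm_eq_abs, abs_of_nonneg (hg0 x),
          mul_comm |Real.log (g x)|, ← mul_add]
        exact mul_le_mul_of_nonneg_left (abs_log_max_sub_log_le
          (le_of_tendsto hx (Eventually.of_forall fun k => hEC k x)) h (by positivity) hr1) (hg0 x)
    linarith
  obtain ⟨k, hk⟩ := (hlim.eventually (gt_mem_nhds hneg)).exists
  refine ⟨k, hintE k, lt_of_le_of_lt ?_ hk⟩
  refine integral_mono (hintE k) (hbint.mono' (hφm k) (Eventually.of_forall (hφb k))) fun x => ?_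
  obtain ⟨a, ha, hale⟩ := hElow k
  refine mul_le_mul_of_nonneg_left (sub_le_sub_right ?_ _) (hg0 x)
  exact Real.log_le_log (ha.trans_le (hale x)) (le_max_left _ _)

end Entropy

/-! ### From an envelope with spikes to a bound on the penalized likelihood. -/

variable {M : ℕ} {f : Fin M → ℝ → ℝ}

lemma one_le_of_mem_paramSpace {θ : Param M} (hθ : θ ∈ paramSpace M) : 1 ≤ M := by
  rcases Nat.eq_zero_or_pos M with rfl | h
  · simpa using hθ.2.1
  · exact h

lemma one_add_sum_le_prod_one_add {ι : Type*} (T : Finset ι) {s : ι → ℝ} (hs : ∀ i, 0 ≤ s i) :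
    1 + ∑ i ∈ T, s i ≤ ∏ i ∈ T, (1 + s i) := by
  classical
  induction T using Finset.induction_on with
  | empty => simp
  | insert i T hi ih =>
    rw [Finset.sum_insert hi, Finset.prod_insert hi]
    nlinarith [hs i, mul_le_mul_of_nonneg_left ih (hs i),
      mul_nonneg (hs i) (Finset.sum_nonneg fun j (_ : j ∈ T) => hs j)]

/-- Turning the sum of spikes into a product lets each spike be paired with the reward of its own
component. -/
lemma add_sum_le_mul_prod {κ E : ℝ} (hκ : 0 < κ) (hE : κ ≤ E) {s : Fin M → ℝ} (hs : ∀ m, 0 ≤ s m) :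
    E + ∑ m, s m ≤ E * ∏ m, (1 + s m / κ) := by
  have h1 : 1 + ∑ m, s m / κ ≤ ∏ m, (1 + s m / κ) :=
    one_add_sum_le_prod_one_add _ fun m => div_nonneg (hs m) hκ.le
  have h2 : ∑ m, s m ≤ E * ∑ m, s m / κ := by
    rw [Finset.mul_sum]
    refine Finset.sum_le_sum fun m _ => ?_
    rw [← mul_div_assoc, le_div_iff₀ hκ, mul_comm]
    exact mul_le_mul_of_nonneg_right hE (hs m)
  calc E + ∑ m, s m ≤ E * (1 + ∑ m, s m / κ) := by linarith
    _ ≤ _ := mul_le_mul_of_nonneg_left h1 (hκ.le.trans hE)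

lemma penalizedLikelihood_le_of_mixture_le (hf : ∀ m, IsDensity (f m)) {θ : Param M}
    (hθ : θ ∈ paramSpace M) {sbar : ℕ → ℝ → ℝ} {n : ℕ} (hsbar : ∀ y > 0, 0 ≤ sbar n y)
    {x : ℕ → ℝ} {E : ℝ → ℝ} {κ C : ℝ} (hκ : 0 < κ) (hE : ∀ y, κ ≤ E y) {s : Fin M → ℝ → ℝ}
    (hs : ∀ m y, 0 ≤ s m y) (hle : ∀ y, mixture f θ y ≤ E y + ∑ m, s m y)
    (hC : ∀ m, (∏ i ∈ Finset.range n, (1 + s m (x i) / κ)) * sbar n (scale θ m) ≤ C) :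
    penalizedLikelihood f sbar n x θ ≤ (∏ i ∈ Finset.range n, E (x i)) * C ^ M := by
  have hE0 : 0 ≤ ∏ i ∈ Finset.range n, E (x i) := Finset.prod_nonneg fun i _ => hκ.le.trans (hE _)
  have hs1 : ∀ m y, 0 ≤ 1 + s m y / κ := fun m y => by
    have := div_nonneg (hs m y) hκ.le
    linarith
  have hrew : 0 ≤ reward sbar n θ := Finset.prod_nonneg fun m _ => hsbar _ (hθ.2.2 m)
  have hlik : likelihood f n x θ ≤
      (∏ i ∈ Finset.range n, E (x i)) * ∏ m, ∏ i ∈ Finset.range n, (1 + s m (x i) / κ) := by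
    rw [Finset.prod_comm, ← Finset.prod_mul_distrib]
    exact Finset.prod_le_prod (fun i _ => mixture_nonneg hf hθ.1 hθ.2.2 _) fun i _ =>
      (hle _).trans (add_sum_le_mul_prod hκ (hE _) fun m => hs m _)
  calc penalizedLikelihood f sbar n x θ
      ≤ (∏ i ∈ Finset.range n, E (x i)) * (∏ m, ∏ i ∈ Finset.range n, (1 + s m (x i) / κ)) *
          reward sbar n θ := mul_le_mul_of_nonneg_right hlik hrew
    _ = (∏ i ∈ Finset.range n, E (x i)) *
          ∏ m, ((∏ i ∈ Finset.range n, (1 + s m (x i) / κ)) * sbar n (scale θ m)) := by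
        rw [Finset.prod_mul_distrib, mul_assoc]
        rfl
    _ ≤ (∏ i ∈ Finset.range n, E (x i)) * ∏ _m : Fin M, C := by
        refine mul_le_mul_of_nonneg_left (Finset.prod_le_prod (fun m _ => ?_) fun m _ => hC m) hE0
        exact mul_nonneg (Finset.prod_nonneg fun i _ => hs1 m _) (hsbar _ (hθ.2.2 m))
    _ = _ := by rw [Finset.prod_const, Finset.card_univ, Fintype.card_fin]

lemma prod_eq_exp_sum_mul_prod {E g : ℝ → ℝ} {x : ℕ → ℝ} (hE : ∀ y, 0 < E y)
    (hg : ∀ i, 0 < g (x i)) (n : ℕ) :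
    ∏ i ∈ Finset.range n, E (x i) =
      Real.exp (∑ i ∈ Finset.range n, (Real.log (E (x i)) - Real.log (g (x i)))) *
        ∏ i ∈ Finset.range n, g (x i) := by
  rw [Real.exp_sum, ← Finset.prod_mul_distrib]
  refine Finset.prod_congr rfl fun i _ => ?_
  rw [Real.exp_sub, Real.exp_log (hE _), Real.exp_log (hg i), div_mul_cancel₀ _ (hg i).ne']

/-- Mass can be lost with the dropped components. Capping each weight at its limit makes every term
converge, including the dropped ones, whose cap is zero. -/
lemma sum_limit_weights_le_one {F : Ultrafilter (Param M)} (hF : paramSpace M ∈ F) {θ : Param M}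
    (h : ∀ m, weight θ m = 0 ∨ Tendsto (fun θ' : Param M => θ' m) F (𝓝 (θ m))) :
    ∑ m, weight θ m ≤ 1 := by
  have hlim : Tendsto (fun θ' : Param M => ∑ m, min (weight θ' m) (weight θ m)) F
      (𝓝 (∑ m, weight θ m)) := by
    refine tendsto_finsetSum _ fun m _ => ?_
    rcases h m with h0 | h1
    · rw [h0]
      refine tendsto_const_nhds.congr' ?_
      filter_upwards [hF] with θ' hθ' using (min_eq_right (hθ'.1 m)).symm
    · have := ((continuous_fst.tendsto _).comp h1).min (tendsto_const_nhds (x := weight θ m))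
      rwa [show (θ m).1 = weight θ m from rfl, min_self] at this
  refine le_of_tendsto hlim ?_
  filter_upwards [hF] with θ' hθ'
  rw [← hθ'.2.1]
  exact Finset.sum_le_sum fun m _ => min_le_left _ _

/-! ### The dichotomy for ultrafilters and the ideal of beaten sets. -/

section Consistency

variable {θ₀ : Param M} {sbar : ℕ → ℝ → ℝ} {Ω : Type*} [MeasurableSpace Ω] {P : Measure Ω}
  {X : ℕ → Ω → ℝ}

/-- Almost surely, for all large `n` the penalized likelihood on `A` stays below its value at the
true parameter. -/
def EventuallyBeaten (f : Fin M → ℝ → ℝ) (θ₀ : Param M) (sbar : ℕ → ℝ → ℝ) (P : Measure Ω)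
    (X : ℕ → Ω → ℝ) (A : Set (Param M)) : Prop :=
  ∀ᵐ ω ∂P, ∀ᶠ n in atTop, ∀ θ ∈ A,
    penalizedLikelihood f sbar n (fun i => X i ω) θ <
      penalizedLikelihood f sbar n (fun i => X i ω) θ₀

lemma ae_separated_and_spread [IsProbabilityMeasure P]
    (hθ₀ : θ₀ ∈ paramSpace M) {v : ℝ} (hv0 : 0 < v) (hv : ∀ m x, f m x ≤ v)
    (hX : ∀ i, Measurable (X i)) (h_indep : iIndepFun X P)
    (h_law : ∀ i, P.map (X i) = volume.withDensity fun x => ENNReal.ofReal (mixture f θ₀ x)) :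
    ∃ B, 0 ≤ B ∧ ∀ᵐ ω ∂P, EventuallySeparated (fun i => X i ω) ∧
      EventuallySpread B fun i => X i ω := by
  set V := ∑ m, v / scale θ₀ m with hV
  have hV0 : 0 < V := by
    have : NeZero M := ⟨Nat.one_le_iff_ne_zero.1 (one_le_of_mem_paramSpace hθ₀)⟩
    exact Finset.sum_pos (fun m _ => div_pos hv0 (hθ₀.2.2 m)) Finset.univ_nonempty
  have hprob : IsProbabilityMeasure
      (volume.withDensity fun x => ENNReal.ofReal (mixture f θ₀ x)) := by
    rw [← h_law 0]
    exact Measure.isProbabilityMeasure_map (hX 0).aemeasurable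
  have hνV : ∀ S, volume.withDensity (fun x => ENNReal.ofReal (mixture f θ₀ x)) S ≤
      ENNReal.ofReal V * volume S := fun S => by
    have h1 : volume.withDensity (fun x => ENNReal.ofReal (mixture f θ₀ x)) ≤
        volume.withDensity fun _ => ENNReal.ofReal V :=
      withDensity_mono (Eventually.of_forall fun x =>
        ENNReal.ofReal_le_ofReal (mixture_le_sum_div hv hv0.le hθ₀ x))
    refine (h1 S).trans (le_of_eq ?_)
    rw [withDensity_const, Measure.smul_apply, smul_eq_mul]
  refine ⟨2 * Real.exp 1 * V + 1, by positivity, ?_⟩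
  filter_upwards [ae_eventuallySeparated hX h_indep h_law hV0.le hνV,
    ae_eventuallySpread hX h_indep h_law hV0 hνV] with ω h1 h2 using ⟨h1, h2⟩

lemma ae_mixture_pos [IsProbabilityMeasure P] (hf : ∀ m, IsDensity (f m))
    (hθ₀ : θ₀ ∈ paramSpace M) (hX : ∀ i, Measurable (X i))
    (h_law : ∀ i, P.map (X i) = volume.withDensity fun x => ENNReal.ofReal (mixture f θ₀ x)) :
    ∀ᵐ ω ∂P, ∀ i, 0 < mixture f θ₀ (X i ω) := by
  refine ae_forall_of_ae_withDensity hX h_law (p := fun x => 0 < mixture f θ₀ x) ?_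
  rw [ae_withDensity_iff'
    (integrable_mixture hf hθ₀.2.2).aestronglyMeasurable.aemeasurable.ennreal_ofReal]
  exact Eventually.of_forall fun x hx => ENNReal.ofReal_pos.1 (pos_iff_ne_zero.2 hx)

/-- The two alternatives correspond to whether the limit mixture agrees with the true density. In
the second, `k` is fixed first by the negative integral, then `c` by the spike bound; the envelope
holds for every `c`, so this order is allowed. -/
lemma le_nhds_or_eventuallyBeaten [IsProbabilityMeasure P] (hf : ∀ m, IsDensity (f m))
    (hθ₀ : θ₀ ∈ paramSpace M) (h_meas : SupMeasurable f) (h_cont : AEContinuousInParam f)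
    (h_log : LogIntegrable f θ₀) (h_tail : TailBound f)
    (h_comp : ¬ HasAtMostComponents f (M - 1) (mixture f θ₀))
    (h_bdd : RewardBounded sbar) (h_decay : RewardDecay M sbar)
    (h_below : RewardBoundedBelow f sbar θ₀)
    (hX : ∀ i, Measurable (X i)) (h_indep : iIndepFun X P)
    (h_law : ∀ i, P.map (X i) = volume.withDensity fun x => ENNReal.ofReal (mixture f θ₀ x))
    {F : Ultrafilter (Param M)} (hF : paramSpace M ∈ F) :
    (∃ θ ∈ equivParams f θ₀, (F : Filter (Param M)) ≤ 𝓝 θ) ∨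
      ∃ A ∈ F, EventuallyBeaten f θ₀ sbar P X A := by
  obtain ⟨v, hv0, v₁, hv₁, β, hβ, hbound⟩ := h_tail
  have hv : ∀ m x, f m x ≤ v := fun m x => (hbound m x).1
  have hM : 1 ≤ M := one_le_of_mem_paramSpace hθ₀
  have hM0 : (0 : ℝ) < M := by exact_mod_cast hM
  choose a μ σ e ha hσ he halt using fun m => exists_componentEnvelope hf h_meas h_cont hv0 hv hv₁
    hβ (fun m x => (hbound m x).2) hF m
  set b := (β - 1) / (2 * β) with hb
  have hb0 : 0 < b := div_pos (by linarith) (by linarith)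
  set θs : Param M := fun m => (a m, μ m, σ m) with hθs
  have hsum : ∑ m, weight θs m ≤ 1 := sum_limit_weights_le_one hF halt
  have hint0 : ∫ x, mixture f θ₀ x = 1 := by rw [integral_mixture hf hθ₀.2.2, hθ₀.2.1]
  have hints : ∫ x, mixture f θs x = ∑ m, weight θs m := integral_mixture hf hσ
  by_cases heq : mixture f θs =ᵐ[volume] mixture f θ₀
  · left
    have hmem : θs ∈ paramSpace M :=
      ⟨ha, by rw [← hints, integral_congr_ae heq, hint0], hσ⟩
    refine ⟨θs, ⟨hmem, heq⟩, ?_⟩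
    -- A vanishing limit weight would represent the true density with at most `M - 1` components.
    have hne : ∀ m, a m ≠ 0 := fun m hm => h_comp ⟨θs, hmem, by
      have hsub : {j | weight θs j ≠ 0} ⊆ (({m}ᶜ : Finset (Fin M)) : Set (Fin M)) := fun j hj => by
        rw [Finset.coe_compl, Finset.coe_singleton, Set.mem_compl_singleton_iff]
        rintro rfl
        exact hj hm
      refine (Set.ncard_le_ncard hsub (Finset.finite_toSet _)).trans (le_of_eq ?_)
      rw [Set.ncard_coe_finset, Finset.card_compl, Finset.card_singleton, Fintype.card_fin],
      heq.symm⟩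
    have : Tendsto (fun θ : Param M => θ) F (𝓝 θs) :=
      tendsto_pi_nhds.2 fun m => (halt m).resolve_left (hne m)
    exact this
  right
  -- The floor `1 / (k + 1)` makes `log (E k)` bounded and serves as `κ` in the spike factors.
  set E : ℕ → ℝ → ℝ := fun k x => 1 / ((k : ℝ) + 1) + ∑ m, e m k x with hE
  have hElow : ∀ (k : ℕ) (x : ℝ), 1 / ((k : ℝ) + 1) ≤ E k x := fun k x =>
    le_add_of_nonneg_right (Finset.sum_nonneg fun m _ => (he m).nonneg k x)
  have hκ : ∀ k : ℕ, 0 < 1 / ((k : ℝ) + 1) := fun k => by positivity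
  have hEm : ∀ k, AEMeasurable (E k) := fun k =>
    aemeasurable_const.add (Finset.aemeasurable_fun_sum _ fun m _ => (he m).aemeasurable k)
  choose C hC using fun m => (he m).bounded
  have hEC : ∀ k x, E k x ≤ 1 + ∑ m, C m := fun k x => by
    refine add_le_add ?_ (Finset.sum_le_sum fun m _ => hC m k x)
    rw [div_le_one (by positivity)]
    linarith [show (0 : ℝ) ≤ k by positivity]
  have hElim : ∀ᵐ x, Tendsto (fun k => E k x) atTop (𝓝 (mixture f θs x)) := by
    filter_upwards [ae_all_iff.2 fun m => (he m).tendsto] with x hx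
    have := (tendsto_one_div_add_atTop_nhds_zero_nat (𝕜 := ℝ)).add
      (tendsto_finsetSum Finset.univ fun m _ => hx m)
    rwa [zero_add] at this
  obtain ⟨k, hkint, hkneg⟩ := exists_integral_mul_log_sub_log_neg
    (mixture_nonneg hf (θ := θs) ha hσ) (mixture_nonneg hf hθ₀.1 hθ₀.2.2)
    (integrable_mixture hf (θ := θs) hσ) (integrable_mixture hf hθ₀.2.2) (hints.trans_le hsum) hint0
    heq h_log hEm (fun k => ⟨_, hκ k, hElow k⟩) hEC hElim
  set δ := -∫ x, mixture f θ₀ x * (Real.log (E k x) - Real.log (mixture f θ₀ x)) with hδ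
  have hδ0 : 0 < δ := neg_pos.2 hkneg
  have hgm : AEMeasurable (mixture f θ₀) :=
    (integrable_mixture hf hθ₀.2.2).aestronglyMeasurable.aemeasurable
  obtain ⟨B, hB, hsample⟩ := ae_separated_and_spread hθ₀ hv0 hv hX h_indep h_law
  -- The exponential budget: the envelope loses more than `δ / 2`, the `M` spikes regain at most `δ
  -- / 4` together, and the remaining `δ / 4` eventually beats `1 / s`.
  obtain ⟨c, hc, hspike⟩ := exists_prod_spike_mul_le hM h_bdd h_decay hv0.le hb0 (hκ k) hB
    (show 0 < δ / (4 * M) by positivity)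
  obtain ⟨s, hs0, N, -, hs⟩ := h_below
  obtain ⟨S, hS⟩ := h_bdd
  refine ⟨{θ | θ ∈ paramSpace M ∧ ∀ m, ∀ x,
    weight θ m * locScale (f m) (loc θ m) (scale θ m) x ≤
      e m k x + spike v b c (loc θ m) (scale θ m) x},
    Filter.inter_mem hF (eventually_all.2 fun m => (he m).le k c hc), ?_⟩
  filter_upwards [hsample, ae_mixture_pos hf hθ₀ hX h_law,
    tendsto_average_of_withDensity hX h_indep (mixture_nonneg hf hθ₀.1 hθ₀.2.2) hgm h_law
      ((hEm k).log.sub hgm.log) hkint] with ω hω hpos havg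
  have havg' := havg.eventually (gt_mem_nhds
    (show ∫ x, mixture f θ₀ x * (Real.log (E k x) - Real.log (mixture f θ₀ x)) < -(δ / 2) by
      linarith))
  filter_upwards [hspike _ hω.1 hω.2, havg', eventually_ge_atTop N, eventually_ge_atTop 1,
    eventually_le_exp_mul (1 / s + 1) (show 0 < δ / 4 by positivity)]
    with n hn1 hn2 hnN hn0 hn3 θ hθ
  have hn : (0 : ℝ) < n := by exact_mod_cast hn0
  have hg0 : 0 < ∏ i ∈ Finset.range n, mixture f θ₀ (X i ω) := Finset.prod_pos fun i _ => hpos i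
  have hupper := penalizedLikelihood_le_of_mixture_le hf hθ.1 (x := fun i => X i ω)
    (s := fun m => spike v b c (loc θ m) (scale θ m))
    (fun y hy => ((hS n hn0).1 y hy).1) (hκ k) (hElow k)
    (fun m y => spike_nonneg hv0.le (hθ.1.2.2 m) y) (fun y => by
      calc mixture f θ y ≤ ∑ m, (e m k y + spike v b c (loc θ m) (scale θ m) y) :=
            Finset.sum_le_sum fun m _ => hθ.2 m y
        _ ≤ _ := by
            rw [Finset.sum_add_distrib]
            exact add_le_add_left (le_add_of_nonneg_left (hκ k).le) _)
    (fun m => hn1 (loc θ m) (scale θ m) (hθ.1.2.2 m))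
  refine hupper.trans_lt ?_
  have hsumlt : ∑ i ∈ Finset.range n,
      (Real.log (E k (X i ω)) - Real.log (mixture f θ₀ (X i ω))) < -(δ / 2) * n :=
    (div_lt_iff₀ hn).1 hn2
  have hexp : Real.exp (δ / (4 * M) * n) ^ M = Real.exp (δ / 4 * n) := by
    rw [← Real.exp_nat_mul]
    congr 1
    field_simp
  rw [hexp, prod_eq_exp_sum_mul_prod (fun y => (hκ k).trans_le (hElow k y)) hpos n]
  have hlt : Real.exp (∑ i ∈ Finset.range n,
      (Real.log (E k (X i ω)) - Real.log (mixture f θ₀ (X i ω)))) * Real.exp (δ / 4 * n) < s := by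
    calc _ ≤ Real.exp (-(δ / 2) * n) * Real.exp (δ / 4 * n) := by gcongr
      _ = (Real.exp (δ / 4 * n))⁻¹ := by
          rw [← Real.exp_add, ← Real.exp_neg]
          congr 1
          ring
      _ < s := by
          rw [inv_lt_comm₀ (Real.exp_pos _) hs0, ← one_div]
          linarith
  calc _ = (∏ i ∈ Finset.range n, mixture f θ₀ (X i ω)) * (Real.exp (∑ i ∈ Finset.range n,
      (Real.log (E k (X i ω)) - Real.log (mixture f θ₀ (X i ω)))) * Real.exp (δ / 4 * n)) := by
        ring
    _ < (∏ i ∈ Finset.range n, mixture f θ₀ (X i ω)) * s := mul_lt_mul_of_pos_left hlt hg0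
    _ ≤ penalizedLikelihood f sbar n (fun i => X i ω) θ₀ :=
        mul_le_mul_of_nonneg_left (hs θ₀ ⟨hθ₀, EventuallyEq.rfl⟩ n hnN) hg0.le

/-- Sets on which the true parameter wins eventually form an ideal, so it suffices to find one
such set in every ultrafilter. -/
lemma eventuallyBeaten_of_ultrafilter {A : Set (Param M)}
    (h : ∀ F : Ultrafilter (Param M), A ∈ F → ∃ A' ∈ F, EventuallyBeaten f θ₀ sbar P X A') :
    EventuallyBeaten f θ₀ sbar P X A := by
  have hmono : ∀ t, EventuallyBeaten f θ₀ sbar P X t → ∀ s ⊆ t, EventuallyBeaten f θ₀ sbar P X s :=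
    fun t ht s hst => ht.mono fun ω hω => hω.mono fun n hn θ hθ => hn θ (hst hθ)
  let G : Filter (Param M) := Filter.comk (EventuallyBeaten f θ₀ sbar P X)
    (by simp [EventuallyBeaten]) hmono fun s hs t ht => by
      filter_upwards [hs, ht] with ω h1 h2
      filter_upwards [h1, h2] with n h3 h4 θ hθ
      exact hθ.elim (h3 θ) (h4 θ)
  by_contra hA
  -- `G` is the filter dual to the ideal. Since `A` is not in the ideal, it meets every member of
  -- `G`, and an ultrafilter refining both contains no beaten set.
  have hne : (G ⊓ 𝓟 A).NeBot := by
    rw [Filter.inf_principal_neBot_iff]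
    intro U hU
    by_contra hempty
    rw [Set.not_nonempty_iff_eq_empty, ← Set.disjoint_iff_inter_eq_empty,
      Set.disjoint_right] at hempty
    exact hA (hmono _ (Filter.mem_comk.1 hU) A hempty)
  obtain ⟨A', hA', hbeat⟩ := h (Ultrafilter.of (G ⊓ 𝓟 A))
    (Ultrafilter.of_le _ (Filter.mem_inf_of_right (Filter.mem_principal_self A)))
  have hcompl : A'ᶜ ∈ Ultrafilter.of (G ⊓ 𝓟 A) := by
    refine Ultrafilter.of_le _ (Filter.mem_inf_of_left (Filter.mem_comk.2 ?_))
    rwa [compl_compl]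
  exact Ultrafilter.compl_notMem_iff.2 hA' hcompl

end Consistency

end LocScaleMixture

theorem theorem2 {M : ℕ} (f : Fin M → ℝ → ℝ) (hf : ∀ m, IsDensity (f m))
    (θ₀ : Param M) (hθ₀ : θ₀ ∈ paramSpace M)
    (h_meas : SupMeasurable f) (h_cont : AEContinuousInParam f)
    (h_log : LogIntegrable f θ₀) (h_tail : TailBound f)
    (h_comp : ¬ HasAtMostComponents f (M - 1) (mixture f θ₀))
    (sbar : ℕ → ℝ → ℝ) (h_bdd : RewardBounded sbar) (h_decay : RewardDecay M sbar)
    (h_below : RewardBoundedBelow f sbar θ₀)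
    {Ω : Type*} [MeasurableSpace Ω] (P : Measure Ω) [IsProbabilityMeasure P]
    (X : ℕ → Ω → ℝ) (hX : ∀ i, Measurable (X i)) (h_indep : iIndepFun X P)
    (h_law : ∀ i, P.map (X i) = volume.withDensity (fun x => ENNReal.ofReal (mixture f θ₀ x)))
    (θhat : ℕ → Ω → Param M)
    (h_mle : ∀ᵐ ω ∂P, ∀ᶠ n in atTop, IsPenalizedMLE f sbar n (fun i => X i ω) (θhat n ω)) :
    StronglyConsistent f P θ₀ θhat := by
  have hbeat : ∀ j : ℕ, EventuallyBeaten f θ₀ sbar P X {θ | θ ∈ paramSpace M ∧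
      ((j : ℝ≥0∞) + 1)⁻¹ ≤ setDist (equivParams f θ) (equivParams f θ₀)} := fun j => by
    refine eventuallyBeaten_of_ultrafilter fun F hF => ?_
    have hΘ : paramSpace M ∈ F := Filter.mem_of_superset hF fun θ hθ => hθ.1
    refine (le_nhds_or_eventuallyBeaten hf hθ₀ h_meas h_cont h_log h_tail h_comp h_bdd h_decay
      h_below hX h_indep h_law hΘ).resolve_left ?_
    -- Convergence to a point of `Θ₀` would put parameters of the set arbitrarily near `Θ₀`, against
    -- the lower bound on their distance.
    rintro ⟨θ, hθ, hle⟩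
    have hj : (0 : ℝ≥0∞) < ((j : ℝ≥0∞) + 1)⁻¹ := by simp
    have hball : ∀ᶠ θ' in (F : Filter (Param M)), edist θ' θ < ((j : ℝ≥0∞) + 1)⁻¹ :=
      hle (Metric.eball_mem_nhds θ hj)
    obtain ⟨θ', h1, h2⟩ := (hball.and hF).exists
    refine absurd h1 (not_lt.2 (h2.2.trans ?_))
    exact (iInf₂_le θ' ⟨h2.1, EventuallyEq.rfl⟩).trans (iInf₂_le θ hθ)
  filter_upwards [h_mle, ae_all_iff.2 hbeat] with ω hω hb
  rw [ENNReal.tendsto_nhds_zero]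
  intro ε hε
  obtain ⟨j, hj⟩ := ENNReal.exists_inv_nat_lt hε.ne'
  filter_upwards [hω, hb j] with n hn hbn
  by_contra hcon
  have hle : ((j : ℝ≥0∞) + 1)⁻¹ ≤ setDist (equivParams f (θhat n ω)) (equivParams f θ₀) :=
    ((ENNReal.inv_le_inv.2 le_self_add).trans hj.le).trans (not_le.1 hcon).le
  -- An estimator far from `Θ₀` would be beaten by `θ₀`, although it maximizes the penalized
  -- likelihood.
  exact (hbn (θhat n ω) ⟨hn.1, hle⟩).not_ge (hn.2 θ₀ hθ₀)
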